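/- Let $\mathbb F_q$ be a finite field with $q$ elements, $A=\mathbb F_q[T]$, $K=\mathbb F_q(T)$, $K_\infty$ the completion of $K$ at $\infty=1/T$ (with $|T|=q$), $\mathbb C_\infty$ the completion of an algebraic closure of $K_\infty$, and $\Omega=\mathbb C_\infty\setminus K_\infty$ the Drinfeld upper half-plane, with $|z|_i:=\inf_{x\in K_\infty}|z-x|$. For $k,m\in\mathbb Z$, $\gamma=\begin{pmatrix}a&b\\c&d\end{pmatrix}\in \mathrm{GL}_2(K_\infty)$ and $f:\Omega\to\mathbb C_\infty$ put $$(f|_{k,m}\gamma)(z)=(\det\gamma)^m(cz+d)^{-k}f\Big(\frac{az+b}{cz+d}\Big).$$ Let $\mathcal O$ be the set of rigid analytic functions $\Omega\to\mathbb C_\infty$ that are invariant under translation by some nonzero ideal of $A$. Let $\Gamma\subseteq \mathrm{GL}_2(A)$ be an arithmetic subgroup of congruence type, i.e. a subgroup commensurable with $\mathrm{GL}_2(A)$ that contains $\Gamma(\mathfrak m)=\ker(\mathrm{GL}_2(A)\to\mathrm{GL}_2(A/\mathfrak m))$ for some nonzero ideal $\mathfrak m$ of $A$. For $k,m\in\mathbb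 Z$ and an integer $\ell\ge 0$, a rigid analytic function $f:\Omega\to\mathbb C_\infty$ is a quasi-modular function of weight $k$, type $m$ and depth $\ell$ for $\Gamma$ if there are $f_0,\dots,f_\ell\in\mathcal O$ with $f_\ell\ne0$ and $$(f|_{k,m}\gamma)(z)=\sum_{i=0}^\ell f_i(z)\Big(\frac{c}{cz+d}\Big)^i\qquad\text{for all } z\in\Omega,\ \gamma=\begin{pmatrix}a&b\\c&d\end{pmatrix}\in\Gamma;$$ by convention $0$ has depth $0$ (with $f_0=0$). It is a quasi-modular form if moreover, for all $0\le i\le \ell$ and all $\gamma\in\mathrm{GL}_2(K)$, $|(f_i|_{k-2i,m-i}\gamma)(z)|$ is bounded as $|z|_i\to\infty$. Let $\widetilde W^{\le\ell}_{k,m}(\Gamma)$ (resp. $\widetilde M^{\le\ell}_{k,m}(\Gamma)$) be the $\mathbb C_\infty$-vector space of quasi-modular functions (resp. forms) of weight $k$, type $m$ and depth at most $\ell$, and let $W_{k,m}(\Gamma)=\widetilde W^{\le0}_{k,m}(\Gamma)$ and $M_{k,m}(\Gamma)=\widetilde M^{\le0}_{k,m}(\Gamma)$ be the spaces of modular functions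 and modular forms. Let $\tilde\pi$ be a period of the Carlitz module $C_T(X)=TX+X^q$, i.e. a generator of the rank one $A$-lattice of zeros of its exponential $e_C(z)=\sum_{i\ge0}z^{q^i}/\prod_{j<i}(T^{q^i}-T^{q^j})$, and let $$E(z)=\tilde\pi^{-1}\sum_{a\in A\text{ monic}}\ \sum_{b\in A}\frac{a}{az+b}$$ be the false Eisenstein series. **Theorem.** Let $k,\ell\ge 0$ and $m$ be integers. Then there are direct sum decompositions $$\widetilde W^{\le\ell}_{k,m}(\Gamma)=\bigoplus_{i=0}^\ell W_{k-2i,m-i}(\Gamma)\,E^i,\qquad \widetilde M^{\le\ell}_{k,m}(\Gamma)=\bigoplus_{i=0}^\ell M_{k-2i,m-i}(\Gamma)\,E^i .$$ Every $f\in\widetilde W^{\le\ell}_{k,m}(\Gamma)$ (resp. $\widetilde M^{\le\ell}_{k,m}(\Gamma)$) is $f=\sum_{i=0}^\ell g_iE^i$ for a unique tuple $(g_0,\dots,g_\ell)$ with $g_i\in W_{k-2i,m-i}(\Gamma)$ (resp. $g_i\in M_{k-2i,m-i}(\Gamma)$), and $g_\ell\neq0$ if $f\neq 0$ has depth exactly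 $\ell$. -/

import Mathlib

open scoped NNReal WithZero Polynomial

namespace DrinfeldQM

universe u

/-! ### The fields `K = F_q(T)`, `K_∞` and `ℂ_∞`

Throughout, `Fq` is a finite field with `q` elements, `A = Fq[X]` (so `T` is `Polynomial.X`) and
`K = RatFunc Fq`. -/

open Classical in
/-- The completion `K_∞` of `F_q(T)` at the place `∞ = 1/T`. -/
def KInfty (Fq : Type u) [Field Fq] : Type u := RatFunc.CompletionAtInfty Fq

open Classical in
noncomputable instance fieldKInfty (Fq : Type u) [Field Fq] : Field (KInfty Fq) :=
  inferInstanceAs (Field (RatFunc.CompletionAtInfty Fq))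

open Classical in
noncomputable instance algebraKInfty (Fq : Type u) [Field Fq] : Algebra (RatFunc Fq) (KInfty Fq) :=
  inferInstanceAs (Algebra (RatFunc Fq) (RatFunc.CompletionAtInfty Fq))

open Classical in
noncomputable instance valuedKInfty (Fq : Type u) [Field Fq] : Valued (KInfty Fq) ℤᵐ⁰ :=
  inferInstanceAs (Valued (RatFunc.CompletionAtInfty Fq) ℤᵐ⁰)

open Classical in
theorem valued_coe (Fq : Type u) [Field Fq] (f : RatFunc Fq) :
    Valued.v (algebraMap (RatFunc Fq) (KInfty Fq) f) = RatFunc.inftyValuation Fq f :=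
  letI := RatFunc.inftyValued Fq
  Valued.extensionValuation_apply_coe f

theorem one_lt_card (Fq : Type u) [Field Fq] [Finite Fq] : (1 : ℝ≥0) < (Nat.card Fq : ℝ≥0) := by
  exact_mod_cast Finite.one_lt_card

/-- The valuation `exp n` corresponds to the real number `q ^ n`. -/
noncomputable instance rankOneKInfty (Fq : Type u) [Field Fq] [Finite Fq] :
    (Valued.v : Valuation (KInfty Fq) ℤᵐ⁰).RankOne where
  hom' := (WithZeroMulInt.toNNReal (one_lt_card Fq).ne_zero).comp
    MonoidWithZeroHom.ValueGroup₀.embedding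
  strictMono' := (WithZeroMulInt.toNNReal_strictMono (one_lt_card Fq)).comp
    MonoidWithZeroHom.ValueGroup₀.embedding_strictMono
  exists_val_nontrivial := ⟨algebraMap (RatFunc Fq) (KInfty Fq) RatFunc.X, by
    classical
    rw [valued_coe]; simp⟩

/-- The normalized absolute value on `K_∞`, with `|T| = q`. -/
noncomputable instance nontriviallyNormedFieldKInfty (Fq : Type u) [Field Fq] [Finite Fq] :
    NontriviallyNormedField (KInfty Fq) :=
  Valued.toNontriviallyNormedField (KInfty Fq) ℤᵐ⁰

theorem norm_KInfty (Fq : Type u) [Field Fq] [Finite Fq] (x : KInfty Fq) :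
    ‖x‖ = WithZeroMulInt.toNNReal (one_lt_card Fq).ne_zero (Valued.v x) := by
  rw [← Valued.v.embedding_restrict x]
  rfl

/-- On `K` the norm is `|f| = q ^ deg f`. -/
theorem norm_coe (Fq : Type u) [Field Fq] [Finite Fq] {f : RatFunc Fq} (hf : f ≠ 0) :
    ‖algebraMap (RatFunc Fq) (KInfty Fq) f‖ = (Nat.card Fq : ℝ) ^ f.intDegree := by
  classical
  rw [norm_KInfty, valued_coe, RatFunc.inftyValuation_apply, RatFunc.inftyValuation_of_nonzero _ hf]
  rw [WithZeroMulInt.toNNReal_neg_apply _ WithZero.exp_ne_zero]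
  push_cast
  rfl

instance isUltrametricDistKInfty (Fq : Type u) [Field Fq] [Finite Fq] :
    IsUltrametricDist (KInfty Fq) :=
  ⟨fun x y z => by
    rw [dist_eq_norm, dist_eq_norm, dist_eq_norm, ← sub_add_sub_cancel x y z]
    exact Valuation.norm_add_le _ (x - y) (y - z)⟩

open Classical in
instance completeSpaceKInfty (Fq : Type u) [Field Fq] [Finite Fq] : CompleteSpace (KInfty Fq) :=
  letI := RatFunc.inftyValued Fq
  inferInstanceAs (CompleteSpace (UniformSpace.Completion (RatFunc Fq)))

/-- An algebraic closure of `K_∞`. -/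
abbrev KInftyAlgCl (Fq : Type u) [Field Fq] : Type u := AlgebraicClosure (KInfty Fq)

/-- The unique extension of the absolute value of `K_∞` to its algebraic closure. -/
noncomputable instance normedFieldAlgCl (Fq : Type u) [Field Fq] [Finite Fq] :
    NormedField (KInftyAlgCl Fq) :=
  spectralNorm.normedField (KInfty Fq) (KInftyAlgCl Fq)

noncomputable instance normedAlgebraAlgCl (Fq : Type u) [Field Fq] [Finite Fq] :
    NormedAlgebra (KInfty Fq) (KInftyAlgCl Fq) :=
  spectralNorm.normedAlgebra (KInfty Fq) (KInftyAlgCl Fq)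

/-- `ℂ_∞`, the completion of an algebraic closure of `K_∞`. -/
abbrev CInfty (Fq : Type u) [Field Fq] [Finite Fq] : Type u :=
  UniformSpace.Completion (KInftyAlgCl Fq)

section

variable {Fq : Type u} [Field Fq] [Finite Fq]

/-- The inclusion `K_∞ ⊆ ℂ_∞`. -/
noncomputable def kInftyToC : KInfty Fq →+* CInfty Fq := algebraMap (KInfty Fq) (CInfty Fq)

/-- The inclusion `A = F_q[T] ⊆ ℂ_∞`. -/
noncomputable def polyToC : Fq[X] →+* CInfty Fq :=
  (kInftyToC.comp (algebraMap (RatFunc Fq) (KInfty Fq))).comp (algebraMap Fq[X] (RatFunc Fq))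

/-! ### The Drinfeld upper half-plane and rigid analytic functions -/

variable (Fq) in
/-- The Drinfeld upper half-plane `Ω = ℙ¹(ℂ_∞) ∖ ℙ¹(K_∞) = ℂ_∞ ∖ K_∞`. -/
def Omega : Set (CInfty Fq) := (Set.range (kInftyToC (Fq := Fq)))ᶜ

/-- The "imaginary part" `|z|_i = inf { |z - x| : x ∈ K_∞ }`. -/
noncomputable def imagAbs (z : CInfty Fq) : ℝ := ⨅ x : KInfty Fq, ‖z - kInftyToC x‖

variable (Fq) in
/-- The affinoid subset `Ω_n = { z : |z| ≤ q ^ n, |z|_i ≥ q ^ (-n) }` of `Ω`. These sets form an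
increasing admissible covering of `Ω`. -/
def OmegaN (n : ℕ) : Set (Omega Fq) :=
  {z | ‖(z : CInfty Fq)‖ ≤ (Nat.card Fq : ℝ) ^ n ∧
    ((Nat.card Fq : ℝ) ^ n)⁻¹ ≤ imagAbs (z : CInfty Fq)}

/-- A function on `Ω` is rigid analytic if on each affinoid `Ω_n` it is a uniform limit of
rational functions without poles on `Ω_n`. -/
def IsRigidAnalytic (f : Omega Fq → CInfty Fq) : Prop :=
  ∀ n : ℕ, ∀ ε : ℝ, 0 < ε → ∃ P Q : (CInfty Fq)[X], ∀ z ∈ OmegaN Fq n,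
    Q.eval (z : CInfty Fq) ≠ 0 ∧
      ‖f z - P.eval (z : CInfty Fq) / Q.eval (z : CInfty Fq)‖ ≤ ε

/-- The set `𝒪` of rigid analytic functions on `Ω` that are `I`-periodic for some nonzero ideal
`I` of `A`. -/
def IsPeriodicAnalytic (f : Omega Fq → CInfty Fq) : Prop :=
  IsRigidAnalytic f ∧ ∃ I : Ideal Fq[X], I ≠ ⊥ ∧
    ∀ a ∈ I, ∀ z w : Omega Fq, (w : CInfty Fq) = z + polyToC a → f w = f z

/-! ### The action of `GL₂(K_∞)` and the slash operator -/

variable (Fq) in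
/-- `GL₂(K)`. -/
abbrev GL2K : Type u := Matrix.GeneralLinearGroup (Fin 2) (RatFunc Fq)

variable (Fq) in
/-- `GL₂(K_∞)`. -/
abbrev GL2KInfty : Type u := Matrix.GeneralLinearGroup (Fin 2) (KInfty Fq)

/-- The inclusion `GL₂(K) ⊆ GL₂(K_∞)`. -/
noncomputable def toGL2KInfty : GL2K Fq →* GL2KInfty Fq :=
  Matrix.GeneralLinearGroup.map (algebraMap (RatFunc Fq) (KInfty Fq))

/-- The entry `γ i j`, seen in `ℂ_∞`. -/
noncomputable def entry (γ : GL2KInfty Fq) (i j : Fin 2) : CInfty Fq := kInftyToC (γ i j)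

/-- `cz + d` for `γ = (a b; c d)`. -/
noncomputable def autFactor (γ : GL2KInfty Fq) (z : Omega Fq) : CInfty Fq :=
  entry γ 1 0 * z + entry γ 1 1

set_option linter.unusedSectionVars false in
theorem det_ne_zero (γ : GL2KInfty Fq) : γ 0 0 * γ 1 1 - γ 0 1 * γ 1 0 ≠ 0 := by
  rw [← Matrix.det_fin_two]
  exact γ.det.ne_zero

/-- No element of `Ω` is a solution of a nontrivial linear equation over `K_∞`. -/
theorem eq_zero_of_linear (z : Omega Fq) (x y : KInfty Fq)
    (h : kInftyToC x * (z : CInfty Fq) + kInftyToC y = 0) : x = 0 ∧ y = 0 := by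
  by_cases hx : x = 0
  · subst hx
    refine ⟨rfl, ?_⟩
    simpa using h
  · exfalso
    apply z.2
    refine ⟨-y / x, ?_⟩
    have hx' : kInftyToC (Fq := Fq) x ≠ 0 := by simpa using hx
    rw [map_div₀, map_neg, div_eq_iff hx']
    linear_combination -h

theorem autFactor_ne_zero (γ : GL2KInfty Fq) (z : Omega Fq) : autFactor γ z ≠ 0 := by
  intro h
  obtain ⟨h1, h2⟩ := eq_zero_of_linear z _ _ h
  apply det_ne_zero γ
  rw [h1, h2]
  ring

/-- The action of `GL₂(K_∞)` on `Ω` by fractional linear transformations. -/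
noncomputable def mobius (γ : GL2KInfty Fq) (z : Omega Fq) : Omega Fq :=
  ⟨(entry γ 0 0 * z + entry γ 0 1) / autFactor γ z, by
    rintro ⟨x, hx⟩
    rw [eq_div_iff (autFactor_ne_zero γ z)] at hx
    have h : kInftyToC (x * γ 1 0 - γ 0 0) * (z : CInfty Fq) +
        kInftyToC (x * γ 1 1 - γ 0 1) = 0 := by
      simp only [map_sub, map_mul]
      unfold autFactor entry at hx
      linear_combination hx
    obtain ⟨h1, h2⟩ := eq_zero_of_linear z _ _ h
    apply det_ne_zero γ
    linear_combination γ 1 0 * h2 - γ 1 1 * h1⟩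

/-- The slash operator `(f |_{k,m} γ)(z) = (det γ)^m (cz+d)^(-k) f(γz)`. -/
noncomputable def slash (k m : ℤ) (f : Omega Fq → CInfty Fq) (γ : GL2KInfty Fq) :
    Omega Fq → CInfty Fq :=
  fun z => kInftyToC (γ.det : KInfty Fq) ^ m * autFactor γ z ^ (-k) * f (mobius γ z)

/-! ### Arithmetic subgroups of congruence type -/

variable (Fq) in
/-- `GL₂(A)`, as a subgroup of `GL₂(K)`. -/
noncomputable def GL2A : Subgroup (GL2K Fq) :=
  (Matrix.GeneralLinearGroup.map (n := Fin 2) (algebraMap Fq[X] (RatFunc Fq))).range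

/-- The principal congruence subgroup `Γ(𝔪)`: the matrices in `GL₂(A)` congruent to the identity
modulo `𝔪`. -/
noncomputable def principalCongruence (I : Ideal Fq[X]) : Subgroup (GL2K Fq) :=
  (Matrix.GeneralLinearGroup.map (n := Fin 2) (Ideal.Quotient.mk I)).ker.map
    (Matrix.GeneralLinearGroup.map (n := Fin 2) (algebraMap Fq[X] (RatFunc Fq)))

/-- Arithmetic subgroups of congruence type of `GL₂(K)`. -/
def IsArithmeticCongruence (Γ : Subgroup (GL2K Fq)) : Prop :=
  Subgroup.Commensurable Γ (GL2A Fq) ∧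
    ∃ I : Ideal Fq[X], I ≠ ⊥ ∧ principalCongruence I ≤ Γ

/-! ### Quasi-modular functions and forms

The polynomial `∑_{i ≤ ℓ} c i * X ^ i` is given by its coefficients `c i`, `i ≤ ℓ`; the values of
`c` at integers `> ℓ` play no role. -/

/-- `c 0, …, c ℓ` lie in `𝒪` and satisfy
`(f |_{k,m} γ)(z) = ∑_{i ≤ ℓ} c i z * (c/(cz+d))^i` for all `γ = (a b; c d) ∈ Γ`. -/
def IsAssociated (Γ : Subgroup (GL2K Fq)) (k m : ℤ) (ℓ : ℕ) (f : Omega Fq → CInfty Fq)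
    (c : ℕ → Omega Fq → CInfty Fq) : Prop :=
  (∀ i ≤ ℓ, IsPeriodicAnalytic (c i)) ∧
    ∀ γ ∈ Γ, ∀ z : Omega Fq, slash k m f (toGL2KInfty γ) z =
      ∑ i ∈ Finset.range (ℓ + 1),
        c i z * (entry (toGL2KInfty γ) 1 0 / autFactor (toGL2KInfty γ) z) ^ i

/-- Drinfeld quasi-modular functions of weight `k`, type `m` and depth (exactly) `ℓ` for `Γ`;
by convention `0` has depth `0`. -/
def QMFunDepth (Γ : Subgroup (GL2K Fq)) (k m : ℤ) (ℓ : ℕ) : Set (Omega Fq → CInfty Fq) :=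
  {f | IsRigidAnalytic f ∧
    ((f = 0 ∧ ℓ = 0) ∨ ∃ c : ℕ → Omega Fq → CInfty Fq, c ℓ ≠ 0 ∧ IsAssociated Γ k m ℓ f c)}

/-- `f` is bounded on vertical lines: `|f(z)|` is bounded as `|z|_i → ∞`. -/
def IsBoundedVertically (f : Omega Fq → CInfty Fq) : Prop :=
  ∃ C R : ℝ, ∀ z : Omega Fq, R ≤ imagAbs (z : CInfty Fq) → ‖f z‖ ≤ C

/-- Holomorphy at the cusps of the coefficients of an associated polynomial:
`c i |_{k-2i,m-i} γ` is bounded on vertical lines for all `i ≤ ℓ` and all `γ ∈ GL₂(K)`. -/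
def IsHolomorphicAtCusps (k m : ℤ) (ℓ : ℕ) (c : ℕ → Omega Fq → CInfty Fq) : Prop :=
  ∀ i ≤ ℓ, ∀ γ : GL2K Fq, IsBoundedVertically (slash (k - 2 * i) (m - i) (c i) (toGL2KInfty γ))

/-- Drinfeld quasi-modular forms of weight `k`, type `m` and depth (exactly) `ℓ` for `Γ`: those
quasi-modular functions whose associated polynomial is holomorphic at the cusps. -/
def QMFormDepth (Γ : Subgroup (GL2K Fq)) (k m : ℤ) (ℓ : ℕ) : Set (Omega Fq → CInfty Fq) :=
  {f | f ∈ QMFunDepth Γ k m ℓ ∧ ∃ c : ℕ → Omega Fq → CInfty Fq,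
    IsAssociated Γ k m ℓ f c ∧ IsHolomorphicAtCusps k m ℓ c}

/-! Closure properties, needed to see that the functions of depth at most `ℓ` form a vector
space. -/

theorem IsRigidAnalytic.zero : IsRigidAnalytic (0 : Omega Fq → CInfty Fq) :=
  fun _ ε hε => ⟨0, 1, fun z _ => by simp [hε.le]⟩

theorem IsRigidAnalytic.add {f g : Omega Fq → CInfty Fq} (hf : IsRigidAnalytic f)
    (hg : IsRigidAnalytic g) : IsRigidAnalytic (f + g) := by
  intro n ε hε
  obtain ⟨P, Q, h⟩ := hf n (ε / 2) (half_pos hε)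
  obtain ⟨P', Q', h'⟩ := hg n (ε / 2) (half_pos hε)
  refine ⟨P * Q' + P' * Q, Q * Q', fun z hz => ?_⟩
  obtain ⟨h1, h2⟩ := h z hz
  obtain ⟨h1', h2'⟩ := h' z hz
  simp only [Polynomial.eval_mul, Polynomial.eval_add, Pi.add_apply]
  refine ⟨mul_ne_zero h1 h1', ?_⟩
  have e : f z + g z - (P.eval (z : CInfty Fq) * Q'.eval (z : CInfty Fq) +
      P'.eval (z : CInfty Fq) * Q.eval (z : CInfty Fq)) /
        (Q.eval (z : CInfty Fq) * Q'.eval (z : CInfty Fq)) =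
      (f z - P.eval (z : CInfty Fq) / Q.eval (z : CInfty Fq)) +
        (g z - P'.eval (z : CInfty Fq) / Q'.eval (z : CInfty Fq)) := by
    field_simp
    ring
  rw [e]
  exact (norm_add_le _ _).trans (by linarith)

theorem IsRigidAnalytic.smul {f : Omega Fq → CInfty Fq} (hf : IsRigidAnalytic f)
    (a : CInfty Fq) : IsRigidAnalytic (a • f) := by
  intro n ε hε
  have ha : 0 < ‖a‖ + 1 := by positivity
  obtain ⟨P, Q, h⟩ := hf n (ε / (‖a‖ + 1)) (div_pos hε ha)
  refine ⟨Polynomial.C a * P, Q, fun z hz => ?_⟩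
  obtain ⟨h1, h2⟩ := h z hz
  refine ⟨h1, ?_⟩
  rw [Polynomial.eval_mul, Polynomial.eval_C, Pi.smul_apply, smul_eq_mul, mul_div_assoc,
    ← mul_sub, norm_mul]
  calc ‖a‖ * _ ≤ (‖a‖ + 1) * (ε / (‖a‖ + 1)) := by gcongr; linarith
    _ = ε := by field_simp

theorem IsPeriodicAnalytic.zero : IsPeriodicAnalytic (0 : Omega Fq → CInfty Fq) :=
  ⟨.zero, ⊤, top_ne_bot, fun _ _ _ _ _ => rfl⟩

theorem IsPeriodicAnalytic.add {f g : Omega Fq → CInfty Fq} (hf : IsPeriodicAnalytic f)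
    (hg : IsPeriodicAnalytic g) : IsPeriodicAnalytic (f + g) := by
  obtain ⟨hf, I, hI, h⟩ := hf
  obtain ⟨hg, J, hJ, h'⟩ := hg
  refine ⟨hf.add hg, I * J, ?_, fun a ha z w hw => ?_⟩
  · rw [ne_eq, Ideal.mul_eq_bot]
    tauto
  · obtain ⟨ha1, ha2⟩ : a ∈ I ∧ a ∈ J := Submodule.mem_inf.1 (Ideal.mul_le_inf ha)
    rw [Pi.add_apply, Pi.add_apply, h a ha1 z w hw, h' a ha2 z w hw]

theorem IsPeriodicAnalytic.smul {f : Omega Fq → CInfty Fq} (hf : IsPeriodicAnalytic f)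
    (a : CInfty Fq) : IsPeriodicAnalytic (a • f) := by
  obtain ⟨hf, I, hI, h⟩ := hf
  exact ⟨hf.smul a, I, hI, fun b hb z w hw => by
    rw [Pi.smul_apply, Pi.smul_apply, h b hb z w hw]⟩

theorem slash_zero (k m : ℤ) (γ : GL2KInfty Fq) :
    slash k m (0 : Omega Fq → CInfty Fq) γ = 0 := by
  funext z
  simp [slash]

theorem slash_add (k m : ℤ) (f g : Omega Fq → CInfty Fq) (γ : GL2KInfty Fq) :
    slash k m (f + g) γ = slash k m f γ + slash k m g γ := by
  funext z
  simp [slash, mul_add]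

theorem slash_smul (k m : ℤ) (a : CInfty Fq) (f : Omega Fq → CInfty Fq) (γ : GL2KInfty Fq) :
    slash k m (a • f) γ = a • slash k m f γ := by
  funext z
  simp only [slash, Pi.smul_apply, smul_eq_mul]
  ring

theorem mobius_one (z : Omega Fq) : mobius 1 z = z := by
  apply Subtype.ext
  simp [mobius, autFactor, entry]

theorem slash_one (k m : ℤ) (f : Omega Fq → CInfty Fq) : slash k m f 1 = f := by
  funext z
  simp [slash, mobius_one, autFactor, entry]

theorem IsBoundedVertically.zero : IsBoundedVertically (0 : Omega Fq → CInfty Fq) :=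
  ⟨0, 0, fun _ _ => by simp⟩

theorem IsBoundedVertically.add {f g : Omega Fq → CInfty Fq} (hf : IsBoundedVertically f)
    (hg : IsBoundedVertically g) : IsBoundedVertically (f + g) := by
  obtain ⟨C, R, h⟩ := hf
  obtain ⟨C', R', h'⟩ := hg
  exact ⟨C + C', max R R', fun z hz => (norm_add_le _ _).trans
    (add_le_add (h z ((le_max_left _ _).trans hz)) (h' z ((le_max_right _ _).trans hz)))⟩

theorem IsBoundedVertically.smul {f : Omega Fq → CInfty Fq} (hf : IsBoundedVertically f)
    (a : CInfty Fq) : IsBoundedVertically (a • f) := by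
  obtain ⟨C, R, h⟩ := hf
  exact ⟨‖a‖ * C, R, fun z hz => by
    rw [Pi.smul_apply, smul_eq_mul, norm_mul]
    exact mul_le_mul_of_nonneg_left (h z hz) (norm_nonneg a)⟩

section

variable {Γ : Subgroup (GL2K Fq)} {k m : ℤ} {ℓ : ℕ} {f g : Omega Fq → CInfty Fq}
  {c d : ℕ → Omega Fq → CInfty Fq}

theorem IsAssociated.eq_zeroth (h : IsAssociated Γ k m ℓ f c) : f = c 0 := by
  funext z
  have := h.2 1 Γ.one_mem z
  rw [map_one, slash_one, Finset.sum_range_succ'] at this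
  simpa [entry] using this

theorem IsAssociated.isRigidAnalytic (h : IsAssociated Γ k m ℓ f c) : IsRigidAnalytic f := by
  rw [h.eq_zeroth]
  exact (h.1 0 (Nat.zero_le _)).1

theorem IsAssociated.zero : IsAssociated Γ k m ℓ 0 0 :=
  ⟨fun _ _ => .zero, fun γ _ z => by simp [slash_zero]⟩

theorem IsAssociated.add (h : IsAssociated Γ k m ℓ f c) (h' : IsAssociated Γ k m ℓ g d) :
    IsAssociated Γ k m ℓ (f + g) (c + d) :=
  ⟨fun i hi => (h.1 i hi).add (h'.1 i hi), fun γ hγ z => by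
    rw [slash_add, Pi.add_apply, h.2 γ hγ, h'.2 γ hγ, ← Finset.sum_add_distrib]
    simp only [Pi.add_apply, add_mul]⟩

theorem IsAssociated.smul (h : IsAssociated Γ k m ℓ f c) (a : CInfty Fq) :
    IsAssociated Γ k m ℓ (a • f) (a • c) :=
  ⟨fun i hi => (h.1 i hi).smul a, fun γ hγ z => by
    rw [slash_smul, Pi.smul_apply, h.2 γ hγ, Finset.smul_sum]
    simp only [Pi.smul_apply, smul_eq_mul, mul_assoc]⟩

theorem IsHolomorphicAtCusps.zero :
    IsHolomorphicAtCusps k m ℓ (0 : ℕ → Omega Fq → CInfty Fq) := fun i _ γ => by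
  rw [Pi.zero_apply, slash_zero]
  exact .zero

theorem IsHolomorphicAtCusps.add (h : IsHolomorphicAtCusps k m ℓ c)
    (h' : IsHolomorphicAtCusps k m ℓ d) : IsHolomorphicAtCusps k m ℓ (c + d) := fun i hi γ => by
  rw [Pi.add_apply, slash_add]
  exact (h i hi γ).add (h' i hi γ)

theorem IsHolomorphicAtCusps.smul (h : IsHolomorphicAtCusps k m ℓ c) (a : CInfty Fq) :
    IsHolomorphicAtCusps k m ℓ (a • c) := fun i hi γ => by
  rw [Pi.smul_apply, slash_smul]
  exact (h i hi γ).smul a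

/-- Padding by zero coefficients. -/
theorem IsAssociated.pad {j : ℕ} (hj : j ≤ ℓ) (h : IsAssociated Γ k m j f c) :
    IsAssociated Γ k m ℓ f (fun i => if i ≤ j then c i else 0) := by
  refine ⟨fun i _ => ?_, fun γ hγ z => ?_⟩
  · dsimp only
    split_ifs with hij
    · exact h.1 i hij
    · exact .zero
  · rw [h.2 γ hγ, ← Finset.sum_subset
      (Finset.range_subset_range.2 (Nat.succ_le_succ hj)) (fun i _ hi => ?_)]
    · refine Finset.sum_congr rfl fun i hi => ?_
      dsimp only
      rw [if_pos (Nat.lt_succ_iff.1 (Finset.mem_range.1 hi))]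
    · dsimp only
      rw [if_neg (fun h' => hi (Finset.mem_range.2 (Nat.lt_succ_of_le h')))]
      simp

theorem IsHolomorphicAtCusps.pad {j : ℕ} (h : IsHolomorphicAtCusps k m j c) :
    IsHolomorphicAtCusps k m ℓ (fun i => if i ≤ j then c i else 0) := fun i _ γ => by
  dsimp only
  split_ifs with hij
  · exact h i hij γ
  · rw [slash_zero]
    exact .zero

theorem exists_depth_le (h : IsAssociated Γ k m ℓ f c) :
    ∃ j ≤ ℓ, f ∈ QMFunDepth Γ k m j ∧ IsAssociated Γ k m j f c := by
  induction ℓ with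
  | zero =>
    refine ⟨0, le_rfl, ⟨h.isRigidAnalytic, ?_⟩, h⟩
    by_cases h0 : c 0 = 0
    · exact Or.inl ⟨h.eq_zeroth.trans h0, rfl⟩
    · exact Or.inr ⟨c, h0, h⟩
  | succ n ih =>
    by_cases h0 : c (n + 1) = 0
    · obtain ⟨j, hj, hf⟩ := ih ⟨fun i hi => h.1 i (hi.trans n.le_succ), fun γ hγ z => by
        rw [h.2 γ hγ, Finset.sum_range_succ, h0]
        simp⟩
      exact ⟨j, hj.trans n.le_succ, hf⟩
    · exact ⟨n + 1, le_rfl, ⟨h.isRigidAnalytic, Or.inr ⟨c, h0, h⟩⟩, h⟩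

theorem exists_qmFunDepth_iff :
    (∃ j ≤ ℓ, f ∈ QMFunDepth Γ k m j) ↔ ∃ c, IsAssociated Γ k m ℓ f c := by
  constructor
  · rintro ⟨j, hj, -, ⟨rfl, rfl⟩ | ⟨c, -, h⟩⟩
    · exact ⟨_, .zero⟩
    · exact ⟨_, h.pad hj⟩
  · rintro ⟨c, h⟩
    obtain ⟨j, hj, hf, -⟩ := exists_depth_le h
    exact ⟨j, hj, hf⟩

theorem exists_qmFormDepth_iff :
    (∃ j ≤ ℓ, f ∈ QMFormDepth Γ k m j) ↔
      ∃ c, IsAssociated Γ k m ℓ f c ∧ IsHolomorphicAtCusps k m ℓ c := by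
  constructor
  · rintro ⟨j, hj, -, c, h, hc⟩
    exact ⟨_, h.pad hj, hc.pad⟩
  · rintro ⟨c, h, hc⟩
    obtain ⟨j, hj, hf, hfc⟩ := exists_depth_le h
    exact ⟨j, hj, hf, c, hfc, fun i hi => hc i (hi.trans hj)⟩

end

/-- The space `W̃_{k,m}^{≤ℓ}(Γ)` of quasi-modular functions of weight `k`, type `m` and depth at
most `ℓ`. -/
def QMFun (Γ : Subgroup (GL2K Fq)) (k m : ℤ) (ℓ : ℕ) :
    Submodule (CInfty Fq) (Omega Fq → CInfty Fq) where
  carrier := {f | ∃ j ≤ ℓ, f ∈ QMFunDepth Γ k m j}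
  zero_mem' := exists_qmFunDepth_iff.2 ⟨_, .zero⟩
  add_mem' hf hg := by
    obtain ⟨c, hc⟩ := exists_qmFunDepth_iff.1 hf
    obtain ⟨d, hd⟩ := exists_qmFunDepth_iff.1 hg
    exact exists_qmFunDepth_iff.2 ⟨_, hc.add hd⟩
  smul_mem' a _ hf := by
    obtain ⟨c, hc⟩ := exists_qmFunDepth_iff.1 hf
    exact exists_qmFunDepth_iff.2 ⟨_, hc.smul a⟩

/-- The space `M̃_{k,m}^{≤ℓ}(Γ)` of quasi-modular forms of weight `k`, type `m` and depth at
most `ℓ`. -/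
def QMForm (Γ : Subgroup (GL2K Fq)) (k m : ℤ) (ℓ : ℕ) :
    Submodule (CInfty Fq) (Omega Fq → CInfty Fq) where
  carrier := {f | ∃ j ≤ ℓ, f ∈ QMFormDepth Γ k m j}
  zero_mem' := exists_qmFormDepth_iff.2 ⟨_, .zero, .zero⟩
  add_mem' hf hg := by
    obtain ⟨c, hc, hc'⟩ := exists_qmFormDepth_iff.1 hf
    obtain ⟨d, hd, hd'⟩ := exists_qmFormDepth_iff.1 hg
    exact exists_qmFormDepth_iff.2 ⟨_, hc.add hd, hc'.add hd'⟩
  smul_mem' a _ hf := by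
    obtain ⟨c, hc, hc'⟩ := exists_qmFormDepth_iff.1 hf
    exact exists_qmFormDepth_iff.2 ⟨_, hc.smul a, hc'.smul a⟩

/-- The space `W_{k,m}(Γ)` of modular functions, i.e. quasi-modular functions of depth `0`. -/
def MFun (Γ : Subgroup (GL2K Fq)) (k m : ℤ) : Submodule (CInfty Fq) (Omega Fq → CInfty Fq) :=
  QMFun Γ k m 0

/-- The space `M_{k,m}(Γ)` of modular forms, i.e. quasi-modular forms of depth `0`. -/
def MForm (Γ : Subgroup (GL2K Fq)) (k m : ℤ) : Submodule (CInfty Fq) (Omega Fq → CInfty Fq) :=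
  QMForm Γ k m 0

/-- For a space `W` of functions and a function `g`, the space `W g = { f g : f ∈ W }`. -/
noncomputable def timesFun (W : Submodule (CInfty Fq) (Omega Fq → CInfty Fq))
    (g : Omega Fq → CInfty Fq) : Submodule (CInfty Fq) (Omega Fq → CInfty Fq) :=
  W.map (LinearMap.mulRight (CInfty Fq) g)

/-! ### The Carlitz period and the false Eisenstein series -/

variable (Fq) in
/-- `D_i = ∏_{j < i} (T^(q^i) - T^(q^j))`. -/
noncomputable def carlitzD (i : ℕ) : Fq[X] :=
  ∏ j ∈ Finset.range i, (Polynomial.X ^ Nat.card Fq ^ i - Polynomial.X ^ Nat.card Fq ^ j)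

/-- The exponential function `e_C(z) = ∑_i z^(q^i) / D_i` of the Carlitz module
`C_T(X) = T X + X^q`. -/
noncomputable def carlitzExp (z : CInfty Fq) : CInfty Fq :=
  ∑' i : ℕ, z ^ Nat.card Fq ^ i / polyToC (carlitzD Fq i)

/-- `π` is a period of the Carlitz module: a generator of the rank one lattice `ker e_C = π A`. -/
def IsCarlitzPeriod (π : CInfty Fq) : Prop :=
  π ≠ 0 ∧ ∀ z : CInfty Fq, carlitzExp z = 0 ↔ ∃ a : Fq[X], z = polyToC a * π

/-- The false Eisenstein series `E(z) = π⁻¹ ∑_{a monic} ∑_{b} a / (a z + b)`. -/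
noncomputable def falseEisenstein (π : CInfty Fq) : Omega Fq → CInfty Fq :=
  fun z => π⁻¹ * ∑' a : {a : Fq[X] // a.Monic}, ∑' b : Fq[X],
    polyToC (a : Fq[X]) / (polyToC (a : Fq[X]) * (z : CInfty Fq) + polyToC b)

end

end DrinfeldQM

/-! The engine is the law `E|_{2,1} γ = E - π⁻¹ X_γ` for `γ` in `GL₂(A)`, where `X_γ(z) = c/(cz+d)`
(`slash_falseEisenstein`). By the binomial theorem, `g E^i` with `g` modular of weight `k-2i` and
type `m-i` is quasi-modular with top coefficient `(-π⁻¹)^i g`.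

Conversely, let `c_0, …, c_ℓ` be associated with `f`. The values `X_γ(z)`, for `γ` in `Γ` and `z`
fixed, form an infinite set (`infinite_cocycleX`), so identities between values at the `X_γ(z)` are
identities of polynomials. With the cocycle rule `cocycleX_mul`, comparing top coefficients in `f|γδ
= (f|γ)|δ` shows that `c_ℓ` is modular of weight `k-2ℓ` and type `m-ℓ`
(`IsAssociated.isModular_top`). Subtracting `(-π)^ℓ c_ℓ E^ℓ` lowers the depth, and induction gives
existence. For uniqueness, slashing `∑ g_i E^i = 0` by `γ` gives `∑ g_i(z) (E(z) - π⁻¹ X_γ(z))^i =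
0`, a polynomial with infinitely many zeros.

For forms one also needs `E|γ` bounded on vertical lines for every `γ` in `GL₂(K)`. This follows
from the law for `E`, the bound `‖a/(az+b)‖ ≤ 1/|z|_i`, and the factorization of `GL₂(K)` as
`GL₂(A)` times upper triangular matrices.

The analytic work lies in the law for `E`, whose double series does not converge unconditionally.
Sums are taken over boxes of pairs `(a, b)` and grouped by translations of `b` by constants: in each
group the `q` equal main parts cancel in characteristic `p`, which leaves small tails. The
inhomogeneous term arises because a box has cardinality zero in `ℂ_∞`, so a box without the origin
counts as `-1`. -/

open Polynomial in
/-- A complete nonarchimedean field with an algebraically closed dense subfield is algebraically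
closed. Unlike `IsAlgClosed.of_denseRange`, this makes no assumption on the characteristic. -/
theorem isAlgClosed_of_denseRange_algebraMap {K L : Type*} [Field K] [NontriviallyNormedField L]
    [CompleteSpace L] [IsUltrametricDist L] [Algebra K L]
    (hi : DenseRange (algebraMap K L)) [IsAlgClosed K] : IsAlgClosed L := by
  apply IsAlgClosed.of_exists_root
  intro f fmon firr
  have fnatdeg0 : f.natDegree ≠ 0 := (Irreducible.natDegree_pos firr).ne'
  let F := f.SplittingField
  let : NormedField F := spectralNorm.normedField L F
  let : NormedAlgebra L F := spectralNorm.normedAlgebra L F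
  have hdeg : (f.map (algebraMap L F)).degree ≠ 0 := by
    simpa using degree_ne_of_natDegree_ne fnatdeg0
  let a := rootOfSplits (SplittingField.splits f) hdeg
  have fa0 : f.aeval a = 0 := by
    rw [← eval_map_algebraMap]
    exact eval_rootOfSplits (Polynomial.SplittingField.splits f) hdeg
  -- It is enough to approximate the root `a` by elements of `L`, because the complete field `L` is
  -- closed in its splitting field extension.
  have hclosed : IsClosed (Set.range (algebraMap L F)) :=
    (algebraMap_isometry L F).isUniformInducing.isComplete_range.isClosed
  have ha : a ∈ Set.range (algebraMap L F) := by
    rw [← hclosed.closure_eq, Metric.mem_closure_iff]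
    intro δ δpos
    -- The root estimate below has the form `((n + 1) ε)^(1/n) * max ‖a‖ 1` with `n` the degree;
    -- this `ε` makes it equal to `δ`.
    have hε : (δ / (max ‖a‖ 1)) ^ f.natDegree / (f.natDegree + 1) > 0 := by positivity
    obtain ⟨g, gmon, gdeg, gcoeff⟩ :=
      exists_monic_and_natDegree_eq_and_norm_map_algebraMap_coeff_sub_lt hi fmon hε
    obtain ⟨b, hb, hab⟩ := exists_aroots_norm_sub_lt_of_norm_coeff_sub_lt
        hε fa0 fmon (gmon.map _) (gdeg ▸ (g.natDegree_map _)) gcoeff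
        (by simpa [Polynomial.map_map] using (IsAlgClosed.splits g).map ((algebraMap L F).comp _))
    have hab : ‖a - b‖ < δ := by
      rw [← Real.rpow_natCast, ← mul_comm_div, div_self, one_mul,
          ← Real.rpow_mul (div_pos δpos (by positivity)).le, mul_inv_cancel₀] at hab
      · simpa [mul_assoc, div_mul_cancel₀ _ (by positivity : (max ‖a‖ 1) > 0).ne'] using hab
      · simp [fnatdeg0]
      · positivity
    -- The polynomial `g` already splits over `K`, so its root `b` comes from `K` through `L`.
    rw [Polynomial.aroots_def, Splits.roots_map ((IsAlgClosed.splits g).map _),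
        Multiset.mem_map] at hb
    obtain ⟨x, -, rfl⟩ := hb
    exact ⟨_, ⟨x, rfl⟩, by rwa [dist_eq_norm]⟩
  obtain ⟨x, hx⟩ := ha
  refine ⟨x, (algebraMap L F).injective ?_⟩
  rw [map_zero, ← fa0, ← hx, aeval_algebraMap_apply, coe_aeval_eq_eval]

namespace DrinfeldQM

universe u

set_option linter.unusedSectionVars false

variable {Fq : Type u} [Field Fq] [Finite Fq]

/-! ### Norms on `ℂ_∞` -/

theorem norm_kInftyToC (x : KInfty Fq) : ‖kInftyToC x‖ = ‖x‖ :=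
  norm_algebraMap' _ _

instance isUltrametricDistCInfty : IsUltrametricDist (CInfty Fq) :=
  IsUltrametricDist.of_normedAlgebra (KInfty Fq)

instance isAlgClosedCInfty : IsAlgClosed (CInfty Fq) := by
  let inst : NontriviallyNormedField (CInfty Fq) :=
    { (inferInstance : NormedField (CInfty Fq)) with
      non_trivial := by
        obtain ⟨x, hx⟩ := NontriviallyNormedField.non_trivial (α := KInfty Fq)
        exact ⟨kInftyToC x, by simpa only [norm_kInftyToC] using hx⟩ }
  exact isAlgClosed_of_denseRange_algebraMap (K := KInftyAlgCl Fq) (L := CInfty Fq)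
    UniformSpace.Completion.denseRange_coe

variable (Fq) in
theorem one_lt_card_real : (1 : ℝ) < Nat.card Fq := by
  exact_mod_cast one_lt_card Fq

variable (Fq) in
theorem card_pos_real : (0 : ℝ) < Nat.card Fq := zero_lt_one.trans (one_lt_card_real Fq)

theorem norm_polyToC {a : Fq[X]} (ha : a ≠ 0) :
    ‖polyToC a‖ = (Nat.card Fq : ℝ) ^ a.natDegree := by
  have h : algebraMap Fq[X] (RatFunc Fq) a ≠ 0 := by simpa using ha
  have := norm_coe Fq h
  rw [RatFunc.intDegree_polynomial, zpow_natCast] at this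
  rw [← this]
  exact norm_kInftyToC _

theorem norm_polyToC_C_le (c : Fq) : ‖polyToC (Polynomial.C c)‖ ≤ 1 := by
  by_cases hc : c = 0
  · simp [hc]
  · rw [norm_polyToC (by simpa using hc)]
    simp

theorem polyToC_eq (a : Fq[X]) :
    polyToC a = kInftyToC (algebraMap (RatFunc Fq) (KInfty Fq) (algebraMap Fq[X] (RatFunc Fq) a)) :=
  rfl

theorem polyToC_injective : Function.Injective (polyToC (Fq := Fq)) :=
  (kInftyToC.injective.comp (algebraMap (RatFunc Fq) (KInfty Fq)).injective).comp
    (RatFunc.algebraMap_injective Fq)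

/-! ### The imaginary part -/

theorem imagAbs_nonneg (z : CInfty Fq) : 0 ≤ imagAbs z :=
  Real.iInf_nonneg fun _ => norm_nonneg _

theorem imagAbs_le (z : CInfty Fq) (x : KInfty Fq) : imagAbs z ≤ ‖z - kInftyToC x‖ :=
  ciInf_le ⟨0, by rintro _ ⟨x, rfl⟩; exact norm_nonneg _⟩ x

/-- `K_∞` is complete, hence closed in `ℂ_∞`, so a point outside it has positive distance to it. -/
theorem imagAbs_pos (z : Omega Fq) : 0 < imagAbs (z : CInfty Fq) := by
  have hclosed : IsClosed (Set.range (kInftyToC (Fq := Fq))) :=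
    (algebraMap_isometry (KInfty Fq) (CInfty Fq)).isUniformInducing.isComplete_range.isClosed
  refine (imagAbs_nonneg _).lt_of_ne fun h => z.2 ?_
  rw [← hclosed.closure_eq, Metric.mem_closure_iff]
  intro ε hε
  obtain ⟨x, hx⟩ := exists_lt_of_ciInf_lt (h ▸ hε : imagAbs (z : CInfty Fq) < ε)
  exact ⟨_, ⟨x, rfl⟩, by rwa [dist_eq_norm]⟩

/-- Factor out `x` and compare with the point `-y/x` of `K_∞`. All later lower bounds for `az + b`
and `cz + d` come from here. -/
theorem mul_imagAbs_le (z : CInfty Fq) (x y : KInfty Fq) :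
    ‖x‖ * imagAbs z ≤ ‖kInftyToC x * z + kInftyToC y‖ := by
  by_cases hx : x = 0
  · simp [hx]
  · have hx' : kInftyToC x ≠ 0 := by simpa using hx
    have e : kInftyToC x * z + kInftyToC y = kInftyToC x * (z - kInftyToC (-y / x)) := by
      rw [map_div₀, map_neg]
      field_simp
      ring
    rw [e, norm_mul, norm_kInftyToC]
    exact mul_le_mul_of_nonneg_left (imagAbs_le _ _) (norm_nonneg _)

theorem exists_mem_OmegaN (z : Omega Fq) : ∃ n, z ∈ OmegaN Fq n := by
  obtain ⟨n, hn⟩ := pow_unbounded_of_one_lt (max ‖(z : CInfty Fq)‖ (imagAbs (z : CInfty Fq))⁻¹)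
    (one_lt_card_real Fq)
  refine ⟨n, (le_max_left _ _).trans hn.le, ?_⟩
  exact inv_le_of_inv_le₀ (imagAbs_pos z) ((le_max_right _ _).trans hn.le)

/-! ### Products and limits of rigid analytic functions -/

/-- By the ultrametric inequality, `Ω_n` contains the open disc of radius `q^(-n)` around each of
its points, so a point outside `Ω_n` cannot be closer than that. -/
theorem inv_card_pow_le_norm_sub {n : ℕ} {α : CInfty Fq}
    (hα : ∀ z ∈ OmegaN Fq n, (z : CInfty Fq) ≠ α)
    {z : Omega Fq} (hz : z ∈ OmegaN Fq n) : ((Nat.card Fq : ℝ) ^ n)⁻¹ ≤ ‖(z : CInfty Fq) - α‖ := by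
  by_contra! h
  have key (x : KInfty Fq) : ((Nat.card Fq : ℝ) ^ n)⁻¹ ≤ ‖α - kInftyToC x‖ := by
    have h1 := hz.2.trans (imagAbs_le (z : CInfty Fq) x)
    rw [← sub_add_sub_cancel (z : CInfty Fq) α] at h1
    rcases le_max_iff.1 (h1.trans (IsUltrametricDist.norm_add_le_max _ _)) with h2 | h2
    · exact absurd h2 (not_le.2 h)
    · exact h2
  have hq : (0 : ℝ) < ((Nat.card Fq : ℝ) ^ n)⁻¹ := inv_pos.2 (pow_pos (card_pos_real Fq) n)
  have hΩ : α ∈ Omega Fq := by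
    rintro ⟨x, rfl⟩
    have := key x
    rw [sub_self, norm_zero] at this
    linarith
  refine hα ⟨α, hΩ⟩ ⟨?_, le_ciInf key⟩ rfl
  have e : α = z + (α - z) := by ring
  have h1 : ((Nat.card Fq : ℝ) ^ n)⁻¹ ≤ (Nat.card Fq : ℝ) ^ n :=
    (inv_le_one_of_one_le₀ (one_le_pow₀ (one_lt_card_real Fq).le)).trans
      (one_le_pow₀ (one_lt_card_real Fq).le)
  calc ‖α‖ = ‖(z : CInfty Fq) + (α - z)‖ := by rw [← e]
    _ ≤ max ‖(z : CInfty Fq)‖ ‖α - z‖ := IsUltrametricDist.norm_add_le_max _ _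
    _ = max ‖(z : CInfty Fq)‖ ‖(z : CInfty Fq) - α‖ := by rw [norm_sub_rev]
    _ ≤ (Nat.card Fq : ℝ) ^ n := max_le hz.1 (h.le.trans h1)

/-- As `ℂ_∞` is algebraically closed, `Q` is a product of linear factors, and each root stays at
distance at least `q^(-n)` from `Ω_n`. This replaces a compactness argument. -/
theorem exists_pos_le_norm_eval {n : ℕ} {Q : (CInfty Fq)[X]}
    (hQ : ∀ z ∈ OmegaN Fq n, Q.eval (z : CInfty Fq) ≠ 0) :
    ∃ δ : ℝ, 0 < δ ∧ ∀ z ∈ OmegaN Fq n, δ ≤ ‖Q.eval (z : CInfty Fq)‖ := by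
  by_cases h0 : Q = 0
  · exact ⟨1, one_pos, fun z hz => absurd (by simp [h0]) (hQ z hz)⟩
  have hq : (0 : ℝ) < ((Nat.card Fq : ℝ) ^ n)⁻¹ := inv_pos.2 (pow_pos (card_pos_real Fq) n)
  refine ⟨‖Q.leadingCoeff‖ * (((Nat.card Fq : ℝ) ^ n)⁻¹) ^ Q.roots.card,
    mul_pos (norm_pos_iff.2 (by simpa using h0)) (pow_pos hq _), fun z hz => ?_⟩
  rw [(IsAlgClosed.splits Q).eval_eq_prod_roots, norm_mul]
  refine mul_le_mul_of_nonneg_left ?_ (norm_nonneg _)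
  have hroots : ∀ α ∈ Q.roots, ∀ w ∈ OmegaN Fq n, (w : CInfty Fq) ≠ α := by
    rintro α hα w hw rfl
    exact hQ w hw (Polynomial.isRoot_of_mem_roots hα)
  revert hroots
  induction Q.roots using Multiset.induction with
  | empty => simp
  | cons a s ih =>
    intro h
    rw [Multiset.map_cons, Multiset.prod_cons, Multiset.card_cons, pow_succ', norm_mul]
    exact mul_le_mul (inv_card_pow_le_norm_sub (h a (Multiset.mem_cons_self a s)) hz)
      (ih fun α hα => h α (Multiset.mem_cons_of_mem hα)) (pow_nonneg hq.le _) (norm_nonneg _)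

theorem exists_norm_eval_le (n : ℕ) (P : (CInfty Fq)[X]) :
    ∃ C : ℝ, ∀ z ∈ OmegaN Fq n, ‖P.eval (z : CInfty Fq)‖ ≤ C := by
  refine ⟨∑ i ∈ Finset.range (P.natDegree + 1), ‖P.coeff i‖ * ((Nat.card Fq : ℝ) ^ n) ^ i,
    fun z hz => ?_⟩
  rw [Polynomial.eval_eq_sum_range]
  refine (norm_sum_le _ _).trans (Finset.sum_le_sum fun i _ => ?_)
  rw [norm_mul, norm_pow]
  exact mul_le_mul_of_nonneg_left (pow_le_pow_left₀ (norm_nonneg _) hz.1 i) (norm_nonneg _)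

theorem exists_norm_div_le {n : ℕ} {P Q : (CInfty Fq)[X]}
    (hQ : ∀ z ∈ OmegaN Fq n, Q.eval (z : CInfty Fq) ≠ 0) :
    ∃ C : ℝ, 0 ≤ C ∧
      ∀ z ∈ OmegaN Fq n, ‖P.eval (z : CInfty Fq) / Q.eval (z : CInfty Fq)‖ ≤ C := by
  obtain ⟨δ, hδ, h⟩ := exists_pos_le_norm_eval hQ
  obtain ⟨C, hC⟩ := exists_norm_eval_le n P
  refine ⟨|C| / δ, by positivity, fun z hz => ?_⟩
  rw [norm_div]
  exact div_le_div₀ (abs_nonneg _) ((hC z hz).trans (le_abs_self C)) hδ (h z hz)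

theorem IsRigidAnalytic.exists_norm_le {f : Omega Fq → CInfty Fq} (hf : IsRigidAnalytic f)
    (n : ℕ) : ∃ C : ℝ, 0 ≤ C ∧ ∀ z ∈ OmegaN Fq n, ‖f z‖ ≤ C := by
  obtain ⟨P, Q, h⟩ := hf n 1 one_pos
  obtain ⟨C, hC0, hC⟩ := exists_norm_div_le (P := P) fun z hz => (h z hz).1
  refine ⟨1 + C, by positivity, fun z hz => ?_⟩
  rw [← sub_add_cancel (f z) (P.eval (z : CInfty Fq) / Q.eval (z : CInfty Fq))]
  exact (norm_add_le _ _).trans (add_le_add (h z hz).2 (hC z hz))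

theorem IsRigidAnalytic.mul {f g : Omega Fq → CInfty Fq} (hf : IsRigidAnalytic f)
    (hg : IsRigidAnalytic g) : IsRigidAnalytic (f * g) := by
  intro n ε hε
  obtain ⟨B, hB0, hB⟩ := hg.exists_norm_le n
  -- The order of choices matters: the precision for `f` depends on the bound `B` of `g`, and the
  -- precision for `g` on the bound `C` of the approximant `P/Q`.
  obtain ⟨P, Q, h⟩ := hf n (ε / 2 / (B + 1)) (by positivity)
  obtain ⟨C, hC0, hC⟩ := exists_norm_div_le (P := P) fun z hz => (h z hz).1
  obtain ⟨P', Q', h'⟩ := hg n (ε / 2 / (C + 1)) (by positivity)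
  refine ⟨P * P', Q * Q', fun z hz => ?_⟩
  obtain ⟨h1, h2⟩ := h z hz
  obtain ⟨h1', h2'⟩ := h' z hz
  simp only [Polynomial.eval_mul, Pi.mul_apply]
  refine ⟨mul_ne_zero h1 h1', ?_⟩
  rw [mul_div_mul_comm]
  have e (a b c d : CInfty Fq) : a * b - c * d = (a - c) * b + c * (b - d) := by ring
  rw [e]
  refine (norm_add_le _ _).trans ?_
  rw [norm_mul, norm_mul]
  have e1 : ε / 2 / (B + 1) * (B + 1) = ε / 2 := by field_simp
  have e2 : (C + 1) * (ε / 2 / (C + 1)) = ε / 2 := by field_simp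
  calc _ ≤ ε / 2 / (B + 1) * (B + 1) + (C + 1) * (ε / 2 / (C + 1)) := by
        gcongr
        · exact (hB z hz).trans (by linarith)
        · exact (hC z hz).trans (by linarith)
    _ = ε := by rw [e1, e2]; ring

theorem IsRigidAnalytic.of_eq_div {f : Omega Fq → CInfty Fq} (P Q : (CInfty Fq)[X])
    (h : ∀ z : Omega Fq, Q.eval (z : CInfty Fq) ≠ 0 ∧
      f z = P.eval (z : CInfty Fq) / Q.eval (z : CInfty Fq)) : IsRigidAnalytic f :=
  fun _ ε hε => ⟨P, Q, fun z _ => ⟨(h z).1, by rw [(h z).2, sub_self, norm_zero]; exact hε.le⟩⟩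

theorem IsRigidAnalytic.one : IsRigidAnalytic (1 : Omega Fq → CInfty Fq) :=
  .of_eq_div 1 1 fun z => by simp

theorem IsRigidAnalytic.pow {f : Omega Fq → CInfty Fq} (hf : IsRigidAnalytic f) (n : ℕ) :
    IsRigidAnalytic (f ^ n) := by
  induction n with
  | zero => simpa using IsRigidAnalytic.one
  | succ n ih => rw [pow_succ]; exact ih.mul hf

theorem IsRigidAnalytic.sum {ι : Type*} {s : Finset ι} {f : ι → Omega Fq → CInfty Fq}
    (h : ∀ i ∈ s, IsRigidAnalytic (f i)) : IsRigidAnalytic (∑ i ∈ s, f i) :=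
  Finset.sum_induction _ _ (fun _ _ ha hb => ha.add hb) .zero h

/-- A function that is a uniform limit of rigid analytic functions on every `Ω_n` is rigid
analytic. -/
theorem IsRigidAnalytic.of_uniform_limit {f : Omega Fq → CInfty Fq}
    (h : ∀ n : ℕ, ∀ ε : ℝ, 0 < ε → ∃ g, IsRigidAnalytic g ∧ ∀ z ∈ OmegaN Fq n, ‖f z - g z‖ ≤ ε) :
    IsRigidAnalytic f := by
  intro n ε hε
  obtain ⟨g, hg, hfg⟩ := h n (ε / 2) (half_pos hε)
  obtain ⟨P, Q, hPQ⟩ := hg n (ε / 2) (half_pos hε)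
  refine ⟨P, Q, fun z hz => ⟨(hPQ z hz).1, ?_⟩⟩
  rw [← sub_add_sub_cancel (f z) (g z)]
  exact (norm_add_le _ _).trans (by linarith [hfg z hz, (hPQ z hz).2])

theorem IsPeriodicAnalytic.mul {f g : Omega Fq → CInfty Fq} (hf : IsPeriodicAnalytic f)
    (hg : IsPeriodicAnalytic g) : IsPeriodicAnalytic (f * g) := by
  obtain ⟨hf, I, hI, h⟩ := hf
  obtain ⟨hg, J, hJ, h'⟩ := hg
  refine ⟨hf.mul hg, I * J, ?_, fun a ha z w hw => ?_⟩
  · rw [ne_eq, Ideal.mul_eq_bot]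
    tauto
  · obtain ⟨ha1, ha2⟩ : a ∈ I ∧ a ∈ J := Submodule.mem_inf.1 (Ideal.mul_le_inf ha)
    rw [Pi.mul_apply, Pi.mul_apply, h a ha1 z w hw, h' a ha2 z w hw]

theorem IsPeriodicAnalytic.one : IsPeriodicAnalytic (1 : Omega Fq → CInfty Fq) :=
  ⟨.one, ⊤, top_ne_bot, fun _ _ _ _ _ => rfl⟩

theorem IsPeriodicAnalytic.pow {f : Omega Fq → CInfty Fq} (hf : IsPeriodicAnalytic f) (n : ℕ) :
    IsPeriodicAnalytic (f ^ n) := by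
  induction n with
  | zero => simpa using IsPeriodicAnalytic.one
  | succ n ih => rw [pow_succ]; exact ih.mul hf

/-! ### Boxes in `A²` -/

theorem finite_degree_lt (N : ℕ) : {a : Fq[X] | a.degree < N}.Finite := by
  have : Finite (Polynomial.degreeLT Fq N) :=
    Finite.of_equiv _ (Polynomial.degreeLTEquiv Fq N).symm.toEquiv
  refine (Set.toFinite (Polynomial.degreeLT Fq N : Set Fq[X])).subset fun a ha => ?_
  exact Polynomial.mem_degreeLT.2 ha

variable (Fq) in
/-- The polynomials of degree less than `N`. -/
noncomputable def polyBox (N : ℕ) : Finset Fq[X] := (finite_degree_lt N).toFinset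

theorem mem_polyBox {N : ℕ} {a : Fq[X]} : a ∈ polyBox Fq N ↔ a.degree < N := by
  simp [polyBox]

theorem zero_mem_polyBox (N : ℕ) : (0 : Fq[X]) ∈ polyBox Fq N := by
  simp [mem_polyBox]

theorem add_mem_polyBox {N : ℕ} {a b : Fq[X]} (ha : a ∈ polyBox Fq N) (hb : b ∈ polyBox Fq N) :
    a + b ∈ polyBox Fq N :=
  mem_polyBox.2 ((Polynomial.degree_add_le _ _).trans_lt
    (max_lt (mem_polyBox.1 ha) (mem_polyBox.1 hb)))

theorem polyBox_mono {M N : ℕ} (h : M ≤ N) : polyBox Fq M ⊆ polyBox Fq N := fun _ ha =>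
  mem_polyBox.2 ((mem_polyBox.1 ha).trans_le (by exact_mod_cast h))

theorem C_mem_polyBox {N : ℕ} (hN : 0 < N) (c : Fq) : Polynomial.C c ∈ polyBox Fq N :=
  mem_polyBox.2 (Polynomial.degree_C_le.trans_lt (by exact_mod_cast hN))

theorem mul_mem_polyBox {M r : ℕ} {a x : Fq[X]} (ha : a ∈ polyBox Fq M) (hx : x.natDegree ≤ r) :
    a * x ∈ polyBox Fq (M + r) := by
  by_cases hx0 : x = 0
  · simpa [hx0] using zero_mem_polyBox _
  by_cases ha0 : a = 0
  · simpa [ha0] using zero_mem_polyBox _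
  rw [mem_polyBox] at *
  rw [Polynomial.degree_lt_iff_coeff_zero] at *
  intro m hm
  apply Polynomial.coeff_eq_zero_of_natDegree_lt
  rw [Polynomial.natDegree_mul ha0 hx0]
  have : a.natDegree < M := by
    by_contra! h
    exact ha0 (Polynomial.leadingCoeff_eq_zero.1 (ha _ h))
  omega

theorem mem_polyBox_natDegree_succ (a : Fq[X]) : a ∈ polyBox Fq (a.natDegree + 1) :=
  mem_polyBox.2 (Polynomial.degree_le_natDegree.trans_lt (by exact_mod_cast Nat.lt_succ_self _))

theorem tendsto_polyBox : Filter.Tendsto (polyBox Fq) Filter.atTop Filter.atTop :=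
  Filter.tendsto_atTop_finset_of_monotone (fun _ _ h => polyBox_mono h)
    fun a => ⟨_, mem_polyBox_natDegree_succ a⟩

theorem le_norm_polyToC {M : ℕ} {a : Fq[X]} (ha : a ∉ polyBox Fq M) :
    (Nat.card Fq : ℝ) ^ M ≤ ‖polyToC a‖ := by
  have h0 : a ≠ 0 := by
    rintro rfl
    exact ha (zero_mem_polyBox M)
  rw [mem_polyBox, not_lt, Polynomial.degree_eq_natDegree h0] at ha
  rw [norm_polyToC h0]
  exact pow_le_pow_right₀ (one_lt_card_real Fq).le (by exact_mod_cast ha)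

variable (Fq) in
/-- The pairs of polynomials of degree less than `N`. -/
noncomputable def pairBox (N : ℕ) : Finset (Fq[X] × Fq[X]) := polyBox Fq N ×ˢ polyBox Fq N

theorem mem_pairBox {N : ℕ} {v : Fq[X] × Fq[X]} :
    v ∈ pairBox Fq N ↔ v.1 ∈ polyBox Fq N ∧ v.2 ∈ polyBox Fq N :=
  Finset.mem_product

theorem zero_mem_pairBox (N : ℕ) : (0 : Fq[X] × Fq[X]) ∈ pairBox Fq N :=
  mem_pairBox.2 ⟨zero_mem_polyBox N, zero_mem_polyBox N⟩

theorem add_mem_pairBox {N : ℕ} {v w : Fq[X] × Fq[X]} (hv : v ∈ pairBox Fq N)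
    (hw : w ∈ pairBox Fq N) : v + w ∈ pairBox Fq N :=
  mem_pairBox.2 ⟨add_mem_polyBox (mem_pairBox.1 hv).1 (mem_pairBox.1 hw).1,
    add_mem_polyBox (mem_pairBox.1 hv).2 (mem_pairBox.1 hw).2⟩

/-! ### Sums over sets stable under constant translations -/

/-- The pair `(0, c)` for a constant `c`. -/
noncomputable def constPair : Fq →+ Fq[X] × Fq[X] :=
  (AddMonoidHom.inr _ _).comp Polynomial.C.toAddMonoidHom

@[simp] theorem constPair_fst (c : Fq) : (constPair c).1 = 0 := rfl

@[simp] theorem constPair_snd (c : Fq) : (constPair c).2 = Polynomial.C c := rfl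

/-- Stability of a set of pairs under `(a, b) ↦ (a, b + c)` for constants `c`. -/
def ConstStable (D : Finset (Fq[X] × Fq[X])) : Prop :=
  ∀ v ∈ D, ∀ c : Fq, v + constPair c ∈ D

theorem constStable_pairBox {N : ℕ} (hN : 0 < N) : ConstStable (pairBox Fq N) := fun _ hv c =>
  add_mem_pairBox hv (mem_pairBox.2 ⟨zero_mem_polyBox N, C_mem_polyBox hN c⟩)

open Classical in
theorem ConstStable.sdiff {D D' : Finset (Fq[X] × Fq[X])} (h : ConstStable D)
    (h' : ConstStable D') : ConstStable (D \ D') := fun v hv c => by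
  rw [Finset.mem_sdiff] at *
  refine ⟨h v hv.1 c, fun hc => hv.2 ?_⟩
  have := h' _ hc (-c)
  rwa [add_assoc, ← map_add, add_neg_cancel, map_zero, add_zero] at this

-- Each class under translation by constants contains exactly one pair whose second entry has
-- constant coefficient zero.
open Classical in
theorem ConstStable.sum_eq [Fintype Fq] {D : Finset (Fq[X] × Fq[X])} (h : ConstStable D)
    {M : Type*} [AddCommMonoid M] (f : Fq[X] × Fq[X] → M) :
    ∑ v ∈ D, f v = ∑ v ∈ D with v.2.coeff 0 = 0, ∑ c : Fq, f (v + constPair c) := by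
  rw [← Finset.sum_product']
  symm
  refine Finset.sum_nbij' (fun p => p.1 + constPair p.2)
    (fun v => (v + constPair (-v.2.coeff 0), v.2.coeff 0)) ?_ ?_ ?_ ?_ ?_
  · rintro ⟨v, c⟩ hv
    simp only [Finset.mem_product, Finset.mem_filter] at hv
    exact h v hv.1.1 c
  · intro v hv
    simp only [Finset.mem_product, Finset.mem_filter]
    exact ⟨⟨h v hv _, by simp⟩, Finset.mem_univ _⟩
  · rintro ⟨v, c⟩ hv
    simp only [Finset.mem_product, Finset.mem_filter] at hv
    have e : (v + constPair c).2.coeff 0 = c := by simp [hv.1.2]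
    rw [e, add_assoc, ← map_add, add_neg_cancel, map_zero, add_zero]
  · intro v hv
    dsimp only
    rw [add_assoc, ← map_add, neg_add_cancel, map_zero, add_zero]
  · intro p hp
    rfl

variable (Fq) in
theorem card_cast_eq_zero [Fintype Fq] : (Fintype.card Fq : CInfty Fq) = 0 := by
  have := congrArg (polyToC.comp Polynomial.C) (FiniteField.cast_card_eq_zero Fq)
  simpa only [map_natCast, map_zero] using this

/-- The set is a union of classes of `q` elements, and `q = 0` in `ℂ_∞`. -/
theorem ConstStable.sum_one {D : Finset (Fq[X] × Fq[X])} (h : ConstStable D) :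
    ∑ _v ∈ D, (1 : CInfty Fq) = 0 := by
  have := Fintype.ofFinite Fq
  rw [h.sum_eq]
  simp [card_cast_eq_zero]

/-! ### The lattice sums -/

/-- The lattice point `a z + b`. -/
noncomputable def latticePoint (z : Omega Fq) (v : Fq[X] × Fq[X]) : CInfty Fq :=
  polyToC v.1 * z + polyToC v.2

/-- The summand `a / (a z + b)`. -/
noncomputable def latticeTerm (z : Omega Fq) (v : Fq[X] × Fq[X]) : CInfty Fq :=
  polyToC v.1 / latticePoint z v

theorem latticePoint_add (z : Omega Fq) (v w : Fq[X] × Fq[X]) :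
    latticePoint z (v + w) = latticePoint z v + latticePoint z w := by
  simp only [latticePoint, Prod.fst_add, Prod.snd_add, map_add]
  ring

theorem latticePoint_eq_zero {z : Omega Fq} {v : Fq[X] × Fq[X]} (h : latticePoint z v = 0) :
    v = 0 := by
  have hinj {a : Fq[X]} (ha : algebraMap (RatFunc Fq) (KInfty Fq)
      (algebraMap Fq[X] (RatFunc Fq) a) = 0) : a = 0 :=
    polyToC_injective (by rw [polyToC_eq, ha, map_zero, map_zero])
  obtain ⟨h1, h2⟩ := eq_zero_of_linear z _ _ h
  exact Prod.ext (hinj h1) (hinj h2)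

theorem latticePoint_ne_zero (z : Omega Fq) {v : Fq[X] × Fq[X]} (h : v ≠ 0) :
    latticePoint z v ≠ 0 := fun h0 => h (latticePoint_eq_zero h0)

section Bounds

variable {n : ℕ} {z : Omega Fq}

theorem norm_fst_le (hz : z ∈ OmegaN Fq n) (v : Fq[X] × Fq[X]) :
    ‖polyToC v.1‖ ≤ (Nat.card Fq : ℝ) ^ n * ‖latticePoint z v‖ := by
  have hq : (0 : ℝ) < (Nat.card Fq : ℝ) ^ n := pow_pos (card_pos_real Fq) n
  have h1 := mul_imagAbs_le (z : CInfty Fq)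
    (algebraMap (RatFunc Fq) (KInfty Fq) (algebraMap Fq[X] (RatFunc Fq) v.1))
    (algebraMap (RatFunc Fq) (KInfty Fq) (algebraMap Fq[X] (RatFunc Fq) v.2))
  rw [← norm_kInftyToC, ← polyToC_eq, ← polyToC_eq] at h1
  have h2 := (mul_le_mul_of_nonneg_left hz.2 (norm_nonneg (polyToC v.1))).trans h1
  rw [← div_eq_mul_inv, div_le_iff₀ hq] at h2
  rw [mul_comm]
  exact h2

theorem norm_fst_le' (hz : z ∈ OmegaN Fq n) (v : Fq[X] × Fq[X]) :
    ‖polyToC v.1‖ ≤ (Nat.card Fq : ℝ) ^ (2 * n) * ‖latticePoint z v‖ :=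
  (norm_fst_le hz v).trans (mul_le_mul_of_nonneg_right
    (pow_le_pow_right₀ (one_lt_card_real Fq).le (by omega)) (norm_nonneg _))

theorem norm_snd_le (hz : z ∈ OmegaN Fq n) (v : Fq[X] × Fq[X]) :
    ‖polyToC v.2‖ ≤ (Nat.card Fq : ℝ) ^ (2 * n) * ‖latticePoint z v‖ := by
  have e : polyToC v.2 = latticePoint z v + -(polyToC v.1 * z) := by
    simp only [latticePoint]; ring
  rw [e]
  refine (IsUltrametricDist.norm_add_le_max _ _).trans (max_le ?_ ?_)
  · exact le_mul_of_one_le_left (norm_nonneg _) (one_le_pow₀ (one_lt_card_real Fq).le)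
  · rw [norm_neg, norm_mul, two_mul, pow_add, mul_right_comm]
    exact mul_le_mul (norm_fst_le hz v) hz.1 (norm_nonneg _) (by positivity)

/-- On `Ω_n` both `‖a‖` and `‖b‖` are at most `q^(2n) ‖az + b‖`, and outside the box one of them is
at least `q^M`. -/
theorem le_norm_latticePoint (hz : z ∈ OmegaN Fq n) {M : ℕ} {v : Fq[X] × Fq[X]}
    (hv : v ∉ pairBox Fq M) :
    (Nat.card Fq : ℝ) ^ M ≤ (Nat.card Fq : ℝ) ^ (2 * n) * ‖latticePoint z v‖ := by
  rw [mem_pairBox, not_and_or] at hv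
  rcases hv with hv | hv
  · exact (le_norm_polyToC hv).trans (norm_fst_le' hz v)
  · exact (le_norm_polyToC hv).trans (norm_snd_le hz v)

variable (Fq) in
/-- The bound for the sums of `latticeTerm` outside `pairBox M`, uniform on `Ω_n`. -/
noncomputable def tailBound (n M : ℕ) : ℝ :=
  (Nat.card Fq : ℝ) ^ (4 * n) * ((Nat.card Fq : ℝ) ^ M)⁻¹

variable (Fq) in
theorem tailBound_nonneg (n M : ℕ) : 0 ≤ tailBound Fq n M :=
  mul_nonneg (pow_nonneg (card_pos_real Fq).le _)
    (inv_nonneg.2 (pow_nonneg (card_pos_real Fq).le _))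

variable (Fq) in
theorem tendsto_tailBound (n : ℕ) :
    Filter.Tendsto (tailBound Fq n) Filter.atTop (nhds 0) := by
  have := (tendsto_inv_atTop_zero.comp
    (tendsto_pow_atTop_atTop_of_one_lt (one_lt_card_real Fq))).const_mul
      ((Nat.card Fq : ℝ) ^ (4 * n))
  rwa [mul_zero] at this

/-- A single term `a/(az+b)` is bounded but need not be small. Summing over the `q` constants
removes the common part and gains a factor `1/(az+b+c)`, which is small outside the box. -/
theorem norm_sum_const_latticeTerm_le [Fintype Fq] (hz : z ∈ OmegaN Fq n) {M : ℕ}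
    {v : Fq[X] × Fq[X]} (hv : ∀ c : Fq, v + constPair c ∉ pairBox Fq M) :
    ‖∑ c : Fq, latticeTerm z (v + constPair c)‖ ≤ tailBound Fq n M := by
  have hne (c : Fq) : latticePoint z (v + constPair c) ≠ 0 :=
    latticePoint_ne_zero z fun h => hv c (h ▸ zero_mem_pairBox M)
  have hne0 : latticePoint z v ≠ 0 := by simpa using hne 0
  have hpt (c : Fq) : latticePoint z (v + constPair c) =
      latticePoint z v + polyToC (Polynomial.C c) := by
    rw [latticePoint_add]; simp [latticePoint]
  -- The first summand does not depend on `c`, so its `q` copies add up to zero.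
  have e (c : Fq) : latticeTerm z (v + constPair c) =
      polyToC v.1 / latticePoint z v + -(polyToC (Polynomial.C c) *
        (polyToC v.1 / latticePoint z v) / latticePoint z (v + constPair c)) := by
    have h1 := hne c
    rw [hpt] at h1
    rw [latticeTerm, hpt, Prod.fst_add, constPair_fst, add_zero]
    field_simp
    ring
  have hq : (0 : ℝ) < Nat.card Fq := card_pos_real Fq
  rw [Finset.sum_congr rfl fun c _ => e c, Finset.sum_add_distrib, Finset.sum_const,
    Finset.card_univ, nsmul_eq_mul, card_cast_eq_zero, zero_mul, zero_add]
  refine IsUltrametricDist.norm_sum_le_of_forall_le_of_nonneg (tailBound_nonneg Fq n M)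
    fun c _ => ?_
  have h1 : ‖polyToC v.1 / latticePoint z v‖ ≤ (Nat.card Fq : ℝ) ^ (2 * n) := by
    rw [norm_div, div_le_iff₀ (norm_pos_iff.2 hne0)]
    exact norm_fst_le' hz v
  have h2 : ‖latticePoint z (v + constPair c)‖⁻¹ ≤
      (Nat.card Fq : ℝ) ^ (2 * n) * ((Nat.card Fq : ℝ) ^ M)⁻¹ := by
    rw [← div_eq_mul_inv, inv_le_iff_one_le_mul₀ (norm_pos_iff.2 (hne c)), div_mul_eq_mul_div,
      one_le_div (pow_pos hq M)]
    exact le_norm_latticePoint hz (hv c)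
  rw [norm_neg, norm_div, norm_mul, div_eq_mul_inv]
  calc _ ≤ 1 * (Nat.card Fq : ℝ) ^ (2 * n) *
        ((Nat.card Fq : ℝ) ^ (2 * n) * ((Nat.card Fq : ℝ) ^ M)⁻¹) := by
        gcongr
        exact norm_polyToC_C_le c
    _ = tailBound Fq n M := by
        rw [tailBound]; ring

/-- Group by constants; the ultrametric inequality makes the bound independent of the number of
groups. This is the substitute for absolute convergence. -/
theorem norm_sum_latticeTerm_le (hz : z ∈ OmegaN Fq n) {M : ℕ} {D : Finset (Fq[X] × Fq[X])}
    (hD : ConstStable D) (hDM : ∀ v ∈ D, v ∉ pairBox Fq M) :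
    ‖∑ v ∈ D, latticeTerm z v‖ ≤ tailBound Fq n M := by
  classical
  have := Fintype.ofFinite Fq
  rw [hD.sum_eq]
  refine IsUltrametricDist.norm_sum_le_of_forall_le_of_nonneg (tailBound_nonneg Fq n M)
    fun v hv => norm_sum_const_latticeTerm_le hz fun c => hDM _ (hD v (Finset.mem_filter.1 hv).1 c)

/-- The sum of `latticeTerm` over a finite set is determined by the box contained in it, up to a
small error. -/
theorem norm_sum_sub_sum_pairBox_le (hz : z ∈ OmegaN Fq n) {M : ℕ} (hM : 0 < M)
    {D : Finset (Fq[X] × Fq[X])} (hD : ConstStable D) (hDM : pairBox Fq M ⊆ D) :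
    ‖∑ v ∈ D, latticeTerm z v - ∑ v ∈ pairBox Fq M, latticeTerm z v‖ ≤ tailBound Fq n M := by
  classical
  rw [← Finset.sum_sdiff hDM, add_sub_cancel_right]
  exact norm_sum_latticeTerm_le hz (hD.sdiff (constStable_pairBox hM))
    fun v hv => (Finset.mem_sdiff.1 hv).2

end Bounds

/-! ### The Eisenstein series as a limit of lattice sums -/

/-- The inner sum `∑_b a / (a z + b)`. -/
noncomputable def rowSum (z : Omega Fq) (a : Fq[X]) : CInfty Fq :=
  ∑' b : Fq[X], latticeTerm z (a, b)

/-- The series `∑_{a monic} ∑_b a / (a z + b)`. -/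
noncomputable def eisensteinSum (z : Omega Fq) : CInfty Fq :=
  ∑' a : {a : Fq[X] // a.Monic}, rowSum z a

theorem falseEisenstein_eq (π : CInfty Fq) (z : Omega Fq) :
    falseEisenstein π z = π⁻¹ * eisensteinSum z := rfl

/-- In a complete nonarchimedean group it suffices that the terms tend to zero, and each box
contains only finitely many indices. -/
theorem summable_of_norm_le {ι : Type*} {e : ι → Fq[X]} (he : Function.Injective e)
    {f : ι → CInfty Fq} {u : ℕ → ℝ} (hu : Filter.Tendsto u Filter.atTop (nhds 0))
    (h : ∀ M, ∀ i, e i ∉ polyBox Fq M → ‖f i‖ ≤ u M) : Summable f := by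
  apply NonarchimedeanAddGroup.summable_of_tendsto_cofinite_zero
  rw [tendsto_zero_iff_norm_tendsto_zero, Metric.tendsto_nhds]
  intro ε hε
  obtain ⟨M, hM⟩ := (hu.eventually_lt_const hε).exists
  have hfin : {i | e i ∈ polyBox Fq M}.Finite :=
    (polyBox Fq M).finite_toSet.preimage he.injOn
  refine hfin.subset fun i hi => ?_
  by_contra h'
  exact hi (by simpa using (h M i h').trans_lt hM)

section Bounds

variable {n : ℕ} {z : Omega Fq}

theorem summable_row (hz : z ∈ OmegaN Fq n) (a : Fq[X]) :
    Summable fun b => latticeTerm z (a, b) := by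
  have hu : Filter.Tendsto (fun M : ℕ => ‖polyToC a‖ * (Nat.card Fq : ℝ) ^ (2 * n) *
      ((Nat.card Fq : ℝ) ^ M)⁻¹) Filter.atTop (nhds 0) := by
    have := (tendsto_inv_atTop_zero.comp
      (tendsto_pow_atTop_atTop_of_one_lt (one_lt_card_real Fq))).const_mul
        (‖polyToC a‖ * (Nat.card Fq : ℝ) ^ (2 * n))
    rwa [mul_zero] at this
  refine summable_of_norm_le Function.injective_id hu fun M b hb => ?_
  have hv : ((a, b) : Fq[X] × Fq[X]) ∉ pairBox Fq M := fun h => hb (mem_pairBox.1 h).2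
  have hne : latticePoint z (a, b) ≠ 0 :=
    latticePoint_ne_zero z fun h => hv (h ▸ zero_mem_pairBox M)
  rw [latticeTerm, norm_div, div_eq_mul_inv, mul_assoc]
  refine mul_le_mul_of_nonneg_left ?_ (norm_nonneg _)
  rw [← div_eq_mul_inv, inv_le_iff_one_le_mul₀ (norm_pos_iff.2 hne), div_mul_eq_mul_div,
    one_le_div (pow_pos (card_pos_real Fq) M)]
  exact le_norm_latticePoint hz hv

theorem tendsto_rowSum (hz : z ∈ OmegaN Fq n) (a : Fq[X]) :
    Filter.Tendsto (fun N => ∑ b ∈ polyBox Fq N, latticeTerm z (a, b)) Filter.atTop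
      (nhds (rowSum z a)) :=
  (summable_row hz a).hasSum.comp tendsto_polyBox

theorem sum_row_eq (a : Fq[X]) (N : ℕ) (z : Omega Fq) :
    ∑ b ∈ polyBox Fq N, latticeTerm z (a, b) =
      ∑ v ∈ {a} ×ˢ polyBox Fq N, latticeTerm z v := by
  rw [Finset.sum_product, Finset.sum_singleton]

theorem constStable_row (a : Fq[X]) {N : ℕ} (hN : 0 < N) :
    ConstStable ({a} ×ˢ polyBox Fq N) := fun v hv c => by
  rw [Finset.mem_product] at *
  refine ⟨by simpa using hv.1, add_mem_polyBox hv.2 (C_mem_polyBox hN c)⟩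

/-- The partial sums of a row over boxes are stable under constants and avoid the box of size `M`.
The decay in `a` makes the outer series converge. -/
theorem norm_rowSum_le (hz : z ∈ OmegaN Fq n) {M : ℕ} {a : Fq[X]} (ha : a ∉ polyBox Fq M) :
    ‖rowSum z a‖ ≤ tailBound Fq n M := by
  refine le_of_tendsto (tendsto_rowSum hz a).norm ?_
  filter_upwards [Filter.eventually_gt_atTop 0] with N hN
  rw [sum_row_eq]
  refine norm_sum_latticeTerm_le hz (constStable_row a hN) fun v hv h => ha ?_
  rw [← Finset.mem_singleton.1 (Finset.mem_product.1 hv).1]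
  exact (mem_pairBox.1 h).1

theorem norm_rowSum_sub_le (hz : z ∈ OmegaN Fq n) {M : ℕ} (hM : 0 < M) (a : Fq[X]) :
    ‖rowSum z a - ∑ b ∈ polyBox Fq M, latticeTerm z (a, b)‖ ≤ tailBound Fq n M := by
  classical
  refine le_of_tendsto ((tendsto_rowSum hz a).sub_const _).norm ?_
  filter_upwards [Filter.eventually_ge_atTop M] with N hN
  have hsub : ({a} : Finset Fq[X]) ×ˢ polyBox Fq M ⊆ {a} ×ˢ polyBox Fq N :=
    Finset.product_subset_product_right (polyBox_mono hN)
  rw [sum_row_eq, sum_row_eq, ← Finset.sum_sdiff hsub, add_sub_cancel_right]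
  refine norm_sum_latticeTerm_le hz
    ((constStable_row a (hM.trans_le hN)).sdiff (constStable_row a hM)) fun v hv h => ?_
  rw [Finset.mem_sdiff, Finset.mem_product, Finset.mem_product] at hv
  exact hv.2 ⟨hv.1.1, (mem_pairBox.1 h).2⟩

open Classical in
/-- Passing from monic polynomials to all polynomials changes the sign. -/
theorem sum_monic_eq_neg (N : ℕ) (g : Fq[X] → CInfty Fq) (h0 : g 0 = 0)
    (hg : ∀ c : Fq, c ≠ 0 → ∀ a, g (Polynomial.C c * a) = g a) :
    ∑ a ∈ polyBox Fq N, g a = -∑ a ∈ polyBox Fq N with a.Monic, g a := by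
  have := Fintype.ofFinite Fq
  -- A nonzero polynomial is uniquely a unit constant (its leading coefficient) times a monic one.
  have key : ∑ a ∈ polyBox Fq N with a ≠ 0, g a =
      ∑ p ∈ (Finset.univ : Finset Fqˣ) ×ˢ (polyBox Fq N).filter Polynomial.Monic, g p.2 := by
    symm
    refine Finset.sum_bij' (fun p _ => Polynomial.C (p.1 : Fq) * p.2)
      (fun a ha => (Units.mk0 a.leadingCoeff
        (Polynomial.leadingCoeff_ne_zero.2 (Finset.mem_filter.1 ha).2),
          Polynomial.C a.leadingCoeff⁻¹ * a)) ?_ ?_ ?_ ?_ ?_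
    · rintro ⟨c, a⟩ hp
      simp only [Finset.mem_product, Finset.mem_filter, mem_polyBox] at hp ⊢
      refine ⟨?_, mul_ne_zero (by simp) hp.2.2.ne_zero⟩
      rw [Polynomial.degree_C_mul c.ne_zero]
      exact hp.2.1
    · intro a ha
      simp only [Finset.mem_product, Finset.mem_filter, mem_polyBox, Finset.mem_univ,
        true_and] at ha ⊢
      have hl : a.leadingCoeff⁻¹ ≠ 0 := by simpa using ha.2
      rw [Polynomial.degree_C_mul hl, mul_comm]
      exact ⟨ha.1, Polynomial.monic_mul_leadingCoeff_inv ha.2⟩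
    · rintro ⟨c, a⟩ hp
      simp only [Finset.mem_product, Finset.mem_filter] at hp
      have hl : (Polynomial.C (c : Fq) * a).leadingCoeff = c := by
        rw [Polynomial.leadingCoeff_mul, Polynomial.leadingCoeff_C, hp.2.2.leadingCoeff, mul_one]
      ext1
      · exact Units.ext hl
      · dsimp only
        rw [hl, ← mul_assoc, ← Polynomial.C_mul, inv_mul_cancel₀ c.ne_zero, Polynomial.C_1, one_mul]
    · intro a ha
      have hl : a.leadingCoeff ≠ 0 :=
        Polynomial.leadingCoeff_ne_zero.2 (Finset.mem_filter.1 ha).2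
      dsimp only
      rw [Units.val_mk0, ← mul_assoc, ← Polynomial.C_mul, mul_inv_cancel₀ hl, Polynomial.C_1,
        one_mul]
    · rintro ⟨c, a⟩ hp
      exact (hg c c.ne_zero a).symm
  have hfil : ∑ a ∈ polyBox Fq N, g a = ∑ a ∈ polyBox Fq N with a ≠ 0, g a := by
    symm
    apply Finset.sum_filter_of_ne
    rintro a - ha rfl
    exact ha h0
  rw [hfil, key, Finset.sum_product]
  dsimp only
  -- There are `q - 1` unit constants, and `q - 1 = -1` in `ℂ_∞`.
  rw [Finset.sum_const, Finset.card_univ, Fintype.card_units,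
    nsmul_eq_mul, Nat.cast_sub Fintype.card_pos, card_cast_eq_zero]
  simp

/-- The quotient `a/(az+b)` is homogeneous of degree zero in `(a, b)`, and scaling by a nonzero
constant permutes the box of `b`. -/
theorem sum_row_mul_C {N : ℕ} {c : Fq} (hc : c ≠ 0) (a : Fq[X]) :
    ∑ b ∈ polyBox Fq N, latticeTerm z (Polynomial.C c * a, b) =
      ∑ b ∈ polyBox Fq N, latticeTerm z (a, b) := by
  have hmem {d : Fq} (hd : d ≠ 0) {b : Fq[X]} (hb : b ∈ polyBox Fq N) :
      Polynomial.C d * b ∈ polyBox Fq N := by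
    rw [mem_polyBox, Polynomial.degree_C_mul hd]
    exact mem_polyBox.1 hb
  have hinv (d e : Fq) (h : d * e = 1) (b : Fq[X]) :
      Polynomial.C d * (Polynomial.C e * b) = b := by
    rw [← mul_assoc, ← Polynomial.C_mul, h, Polynomial.C_1, one_mul]
  refine Finset.sum_nbij' (fun b => Polynomial.C c⁻¹ * b) (fun b => Polynomial.C c * b)
    (fun b hb => hmem (inv_ne_zero hc) hb) (fun b hb => hmem hc hb)
    (fun b _ => hinv _ _ (mul_inv_cancel₀ hc) b) (fun b _ => hinv _ _ (inv_mul_cancel₀ hc) b)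
    fun b _ => ?_
  have hc' : polyToC (Polynomial.C c) ≠ 0 := by
    rw [ne_eq, map_eq_zero_iff _ polyToC_injective]
    simpa using hc
  have e : polyToC b = polyToC (Polynomial.C c) * polyToC (Polynomial.C c⁻¹ * b) := by
    rw [← map_mul, hinv _ _ (mul_inv_cancel₀ hc)]
  simp only [latticeTerm, latticePoint]
  rw [e, map_mul polyToC (Polynomial.C c) a, mul_assoc, ← mul_add, mul_div_mul_left _ _ hc']

/-- The Eisenstein series is the limit of the sums over boxes, uniformly on `Ω_n`. -/
theorem norm_eisensteinSum_add_le (hz : z ∈ OmegaN Fq n) {M : ℕ} (hM : 0 < M) :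
    ‖eisensteinSum z + ∑ v ∈ pairBox Fq M, latticeTerm z v‖ ≤ tailBound Fq n M := by
  classical
  have h1 : ∑ v ∈ pairBox Fq M, latticeTerm z v =
      -∑ a ∈ (polyBox Fq M).subtype Polynomial.Monic,
        ∑ b ∈ polyBox Fq M, latticeTerm z ((a : Fq[X]), b) := by
    rw [pairBox, Finset.sum_product, sum_monic_eq_neg M _ (by simp [latticeTerm])
      fun c hc a => sum_row_mul_C hc a]
    exact congrArg Neg.neg (Finset.sum_subtype_eq_sum_filter
      fun a => ∑ b ∈ polyBox Fq M, latticeTerm z (a, b)).symm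
  have hs : Summable fun a : {a : Fq[X] // a.Monic} => rowSum z a :=
    summable_of_norm_le Subtype.val_injective (tendsto_tailBound Fq n)
      fun M a ha => norm_rowSum_le hz ha
  -- Extending the finite box sum by zero turns the difference into one series, estimated row by
  -- row: inside the box only the tail of the row is left, outside it the whole row.
  set F : {a : Fq[X] // a.Monic} → CInfty Fq := fun a =>
    if a ∈ (polyBox Fq M).subtype Polynomial.Monic then
      ∑ b ∈ polyBox Fq M, latticeTerm z ((a : Fq[X]), b) else 0 with hF
  have hFs : HasSum F (∑ a ∈ (polyBox Fq M).subtype Polynomial.Monic, F a) :=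
    hasSum_sum_of_ne_finset_zero fun a ha => if_neg ha
  have hFe : ∑ a ∈ (polyBox Fq M).subtype Polynomial.Monic, F a =
      ∑ a ∈ (polyBox Fq M).subtype Polynomial.Monic,
        ∑ b ∈ polyBox Fq M, latticeTerm z ((a : Fq[X]), b) :=
    Finset.sum_congr rfl fun a ha => if_pos ha
  rw [h1, ← hFe, ← sub_eq_add_neg, eisensteinSum, ← (hs.hasSum.sub hFs).tsum_eq]
  have : Nonempty {a : Fq[X] // a.Monic} := ⟨⟨1, Polynomial.monic_one⟩⟩
  refine IsUltrametricDist.norm_tsum_le_of_forall_le fun a => ?_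
  by_cases ha : a ∈ (polyBox Fq M).subtype Polynomial.Monic
  · rw [hF]
    dsimp only
    rw [if_pos ha]
    exact norm_rowSum_sub_le hz hM a
  · rw [hF]
    dsimp only
    rw [if_neg ha, sub_zero]
    exact norm_rowSum_le hz fun h => ha (Finset.mem_subtype.2 h)

end Bounds

/-! ### Analyticity of the Eisenstein series -/

theorem isRigidAnalytic_latticeTerm (v : Fq[X] × Fq[X]) :
    IsRigidAnalytic fun z => latticeTerm z v := by
  by_cases hv : v = 0
  · subst hv
    refine .of_eq_div 0 1 fun z => by simp [latticeTerm]
  · refine .of_eq_div (Polynomial.C (polyToC v.1))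
      (Polynomial.C (polyToC v.1) * Polynomial.X + Polynomial.C (polyToC v.2)) fun z => ?_
    have e : (Polynomial.C (polyToC v.1) * Polynomial.X + Polynomial.C (polyToC v.2)).eval
        (z : CInfty Fq) = latticePoint z v := by simp [latticePoint]
    rw [e]
    exact ⟨latticePoint_ne_zero z hv, by simp [latticeTerm]⟩

theorem isRigidAnalytic_eisensteinSum : IsRigidAnalytic (eisensteinSum (Fq := Fq)) := by
  refine .of_uniform_limit fun n ε hε => ?_
  obtain ⟨M, hM, hM0⟩ := (((tendsto_tailBound Fq n).eventually_lt_const hε).and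
    (Filter.eventually_gt_atTop 0)).exists
  refine ⟨(-1 : CInfty Fq) • ∑ v ∈ pairBox Fq M, fun z => latticeTerm z v,
    (IsRigidAnalytic.sum fun v _ => isRigidAnalytic_latticeTerm v).smul _, fun z hz => ?_⟩
  rw [Pi.smul_apply, neg_one_smul, Finset.sum_apply, sub_neg_eq_add]
  exact (norm_eisensteinSum_add_le hz hM0).trans hM.le

/-! ### The transformation of the Eisenstein series under `GL₂(A)` -/

/-- The row vector `v` times the matrix `x`. -/
noncomputable def rowMul (x : Matrix (Fin 2) (Fin 2) Fq[X]) : Fq[X] × Fq[X] →+ Fq[X] × Fq[X] where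
  toFun v := (v.1 * x 0 0 + v.2 * x 1 0, v.1 * x 0 1 + v.2 * x 1 1)
  map_zero' := by simp
  map_add' v w := by
    ext1 <;> simp only [Prod.fst_add, Prod.snd_add] <;> ring

theorem rowMul_apply (x : Matrix (Fin 2) (Fin 2) Fq[X]) (v : Fq[X] × Fq[X]) :
    rowMul x v = (v.1 * x 0 0 + v.2 * x 1 0, v.1 * x 0 1 + v.2 * x 1 1) := rfl

theorem rowMul_rowMul (x y : Matrix (Fin 2) (Fin 2) Fq[X]) (v : Fq[X] × Fq[X]) :
    rowMul y (rowMul x v) = rowMul (x * y) v := by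
  simp only [rowMul_apply, Matrix.mul_apply, Fin.sum_univ_two]
  ext1 <;> ring

theorem rowMul_one (v : Fq[X] × Fq[X]) : rowMul 1 v = v := by
  simp [rowMul_apply]

theorem exists_rowMul_mem (x : Matrix (Fin 2) (Fin 2) Fq[X]) :
    ∃ r, ∀ M, ∀ v ∈ pairBox Fq M, rowMul x v ∈ pairBox Fq (M + r) := by
  refine ⟨(x 0 0).natDegree + (x 1 0).natDegree + (x 0 1).natDegree + (x 1 1).natDegree,
    fun M v hv => ?_⟩
  obtain ⟨h1, h2⟩ := mem_pairBox.1 hv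
  rw [mem_pairBox, rowMul_apply]
  exact ⟨add_mem_polyBox (mul_mem_polyBox h1 (by omega)) (mul_mem_polyBox h2 (by omega)),
    add_mem_polyBox (mul_mem_polyBox h1 (by omega)) (mul_mem_polyBox h2 (by omega))⟩

variable (Fq) in
/-- The inclusion `GL₂(A) → GL₂(K_∞)`. -/
noncomputable def polyGL : Matrix.GeneralLinearGroup (Fin 2) Fq[X] →* GL2KInfty Fq :=
  toGL2KInfty.comp (Matrix.GeneralLinearGroup.map (n := Fin 2) (algebraMap Fq[X] (RatFunc Fq)))

theorem entry_polyGL (g : Matrix.GeneralLinearGroup (Fin 2) Fq[X]) (i j : Fin 2) :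
    entry (polyGL Fq g) i j = polyToC (g i j) := rfl

/-- The determinant, seen in `ℂ_∞`. -/
noncomputable def detC (γ : GL2KInfty Fq) : CInfty Fq := kInftyToC (γ.det : KInfty Fq)

theorem detC_eq (γ : GL2KInfty Fq) :
    detC γ = entry γ 0 0 * entry γ 1 1 - entry γ 0 1 * entry γ 1 0 := by
  have : (γ.det : KInfty Fq) = γ 0 0 * γ 1 1 - γ 0 1 * γ 1 0 := Matrix.det_fin_two _
  rw [detC, this]
  simp only [entry, map_sub, map_mul]

theorem detC_ne_zero (γ : GL2KInfty Fq) : detC γ ≠ 0 :=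
  (map_ne_zero _).2 γ.det.ne_zero

theorem coe_mobius (γ : GL2KInfty Fq) (z : Omega Fq) :
    (mobius γ z : CInfty Fq) = (entry γ 0 0 * z + entry γ 0 1) / autFactor γ z := rfl

theorem latticePoint_rowMul (g : Matrix.GeneralLinearGroup (Fin 2) Fq[X]) (z : Omega Fq)
    (v : Fq[X] × Fq[X]) :
    latticePoint z (rowMul g v) =
      autFactor (polyGL Fq g) z * latticePoint (mobius (polyGL Fq g) z) v := by
  have hj := autFactor_ne_zero (polyGL Fq g) z
  rw [latticePoint, latticePoint, coe_mobius, mul_add, mul_left_comm, mul_div_cancel₀ _ hj]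
  simp only [autFactor, entry_polyGL, rowMul_apply, map_add, map_mul]
  ring

theorem rowMul_injective (g : Matrix.GeneralLinearGroup (Fin 2) Fq[X]) :
    Function.Injective (rowMul (Fq := Fq) g) := by
  intro v w h
  have := congrArg (rowMul (g⁻¹).1) h
  rwa [rowMul_rowMul, rowMul_rowMul, ← Units.val_mul, mul_inv_cancel, Units.val_one, rowMul_one,
    rowMul_one] at this

/-- With `(a', b') = v g`, solving for the first entry of `v` gives `a det g = a' d - b' c = a'
(cz+d) - c (a'z+b')`. Dividing by the lattice point leaves a correction independent of `v`. At `v =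
0` both terms vanish by `0/0 = 0` but the correction does not, whence the hypothesis. -/
theorem latticeTerm_mobius (g : Matrix.GeneralLinearGroup (Fin 2) Fq[X]) (z : Omega Fq)
    {v : Fq[X] × Fq[X]} (hv : v ≠ 0) :
    latticeTerm (mobius (polyGL Fq g) z) v =
      autFactor (polyGL Fq g) z ^ 2 / detC (polyGL Fq g) * latticeTerm z (rowMul g v) -
        entry (polyGL Fq g) 1 0 * autFactor (polyGL Fq g) z / detC (polyGL Fq g) := by
  have hj := autFactor_ne_zero (polyGL Fq g) z
  have hd := detC_ne_zero (polyGL Fq g)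
  have hp := latticePoint_ne_zero (mobius (polyGL Fq g) z) hv
  have hfst : polyToC v.1 * detC (polyGL Fq g) =
      polyToC (rowMul g v).1 * autFactor (polyGL Fq g) z -
        entry (polyGL Fq g) 1 0 * latticePoint z (rowMul g v) := by
    simp only [detC_eq, autFactor, latticePoint, entry_polyGL, rowMul_apply, map_add, map_mul]
    ring
  rw [latticePoint_rowMul] at hfst
  rw [latticeTerm, latticeTerm, latticePoint_rowMul]
  generalize latticePoint (mobius (polyGL Fq g) z) v = P at *
  generalize autFactor (polyGL Fq g) z = j at *
  generalize detC (polyGL Fq g) = d at *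
  field_simp
  linear_combination hfst

/-- The correction is summed over the box without the origin, whose cardinality is `-1` in `ℂ_∞`.
This is the source of the inhomogeneous term of `E`. -/
theorem sum_latticeTerm_mobius (g : Matrix.GeneralLinearGroup (Fin 2) Fq[X]) (z : Omega Fq)
    {N : ℕ} (hN : 0 < N) :
    ∑ v ∈ pairBox Fq N, latticeTerm (mobius (polyGL Fq g) z) v =
      autFactor (polyGL Fq g) z ^ 2 / detC (polyGL Fq g) *
        ∑ v ∈ pairBox Fq N, latticeTerm z (rowMul g v) +
        entry (polyGL Fq g) 1 0 * autFactor (polyGL Fq g) z / detC (polyGL Fq g) := by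
  classical
  have h1 := (constStable_pairBox (Fq := Fq) hN).sum_one
  rw [← Finset.add_sum_erase _ _ (zero_mem_pairBox N)] at h1 ⊢
  rw [← Finset.add_sum_erase (pairBox Fq N) (fun v => latticeTerm z (rowMul g v))
    (zero_mem_pairBox N), Finset.sum_congr rfl fun v hv =>
      latticeTerm_mobius g z (Finset.mem_erase.1 hv).1, Finset.sum_sub_distrib, ← Finset.mul_sum]
  have e (x : CInfty Fq) : ∑ _v ∈ (pairBox Fq N).erase 0, x =
      x * ∑ _v ∈ (pairBox Fq N).erase 0, (1 : CInfty Fq) := by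
    rw [Finset.mul_sum]; simp
  rw [e (_ / _), eq_neg_of_add_eq_zero_right h1, map_zero]
  have h0 (w : Omega Fq) : latticeTerm w 0 = 0 := by simp [latticeTerm]
  rw [h0, h0]
  ring

theorem tendsto_sum_pairBox (z : Omega Fq) :
    Filter.Tendsto (fun M => ∑ v ∈ pairBox Fq M, latticeTerm z v) Filter.atTop
      (nhds (-eisensteinSum z)) := by
  obtain ⟨n, hz⟩ := exists_mem_OmegaN z
  rw [tendsto_iff_norm_sub_tendsto_zero]
  refine squeeze_zero' (.of_forall fun _ => norm_nonneg _) ?_ (tendsto_tailBound Fq n)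
  filter_upwards [Filter.eventually_gt_atTop 0] with M hM
  rw [sub_neg_eq_add, add_comm]
  exact norm_eisensteinSum_add_le hz hM

/-- The image under `g` of the box of size `M + r` contains the box of size `M`, where `r` bounds
the degree growth under `g⁻¹`, and it is stable under constants. The two sums therefore differ by a
tail. -/
theorem tendsto_sum_rowMul (g : Matrix.GeneralLinearGroup (Fin 2) Fq[X]) (z : Omega Fq) :
    Filter.Tendsto (fun M => ∑ v ∈ pairBox Fq M, latticeTerm z (rowMul g v)) Filter.atTop
      (nhds (-eisensteinSum z)) := by
  classical
  obtain ⟨n, hz⟩ := exists_mem_OmegaN z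
  obtain ⟨r, hr⟩ := exists_rowMul_mem (g⁻¹).1
  have hback (v : Fq[X] × Fq[X]) : rowMul g (rowMul (g⁻¹).1 v) = v := by
    rw [rowMul_rowMul, ← Units.val_mul, inv_mul_cancel, Units.val_one, rowMul_one]
  rw [← Filter.tendsto_add_atTop_iff_nat r]
  have key : Filter.Tendsto (fun M => ∑ v ∈ pairBox Fq (M + r), latticeTerm z (rowMul g v) -
      ∑ v ∈ pairBox Fq M, latticeTerm z v) Filter.atTop (nhds 0) := by
    rw [tendsto_zero_iff_norm_tendsto_zero]
    refine squeeze_zero' (.of_forall fun _ => norm_nonneg _) ?_ (tendsto_tailBound Fq n)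
    filter_upwards [Filter.eventually_gt_atTop 0] with M hM
    have himg (v) (hv : v ∈ pairBox Fq M) : v ∈ (pairBox Fq (M + r)).image (rowMul g) :=
      Finset.mem_image.2 ⟨_, hr M v hv, hback v⟩
    rw [← Finset.sum_image (f := latticeTerm z) (rowMul_injective g).injOn]
    refine norm_sum_sub_sum_pairBox_le hz hM (fun v hv c => ?_) himg
    obtain ⟨w, hw, rfl⟩ := Finset.mem_image.1 hv
    refine Finset.mem_image.2 ⟨w + rowMul (g⁻¹).1 (constPair c), add_mem_pairBox hw
      (hr M _ (mem_pairBox.2 ⟨zero_mem_polyBox M, C_mem_polyBox hM c⟩)), ?_⟩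
    rw [map_add, hback]
  simpa using key.add (tendsto_sum_pairBox z)

theorem eisensteinSum_mobius (g : Matrix.GeneralLinearGroup (Fin 2) Fq[X]) (z : Omega Fq) :
    eisensteinSum (mobius (polyGL Fq g) z) =
      autFactor (polyGL Fq g) z ^ 2 / detC (polyGL Fq g) * eisensteinSum z -
        entry (polyGL Fq g) 1 0 * autFactor (polyGL Fq g) z / detC (polyGL Fq g) := by
  have h1 := tendsto_sum_pairBox (mobius (polyGL Fq g) z)
  have h2 := ((tendsto_sum_rowMul g z).const_mul
    (autFactor (polyGL Fq g) z ^ 2 / detC (polyGL Fq g))).add_const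
      (entry (polyGL Fq g) 1 0 * autFactor (polyGL Fq g) z / detC (polyGL Fq g))
  have h3 := tendsto_nhds_unique h1 (h2.congr' (by
    filter_upwards [Filter.eventually_gt_atTop 0] with M hM
    exact (sum_latticeTerm_mobius g z hM).symm))
  linear_combination -h3

/-! ### The false Eisenstein series -/

theorem isRigidAnalytic_falseEisenstein (π : CInfty Fq) : IsRigidAnalytic (falseEisenstein π) :=
  isRigidAnalytic_eisensteinSum.smul π⁻¹

theorem slash_falseEisenstein (π : CInfty Fq) (g : Matrix.GeneralLinearGroup (Fin 2) Fq[X])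
    (z : Omega Fq) :
    slash 2 1 (falseEisenstein π) (polyGL Fq g) z =
      falseEisenstein π z - π⁻¹ * (entry (polyGL Fq g) 1 0 / autFactor (polyGL Fq g) z) := by
  have hj := autFactor_ne_zero (polyGL Fq g) z
  have hd := detC_ne_zero (polyGL Fq g)
  rw [slash, falseEisenstein_eq, falseEisenstein_eq, eisensteinSum_mobius, zpow_neg, zpow_one]
  change detC (polyGL Fq g) * _ * _ = _
  generalize autFactor (polyGL Fq g) z = j at *
  generalize detC (polyGL Fq g) = d at *
  rw [show (2 : ℤ) = ((2 : ℕ) : ℤ) from rfl, zpow_natCast]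
  field_simp

/-- The matrix `(1 a; 0 1)`. -/
noncomputable def upperUnipotent (a : Fq[X]) : Matrix.GeneralLinearGroup (Fin 2) Fq[X] where
  val := !![1, a; 0, 1]
  inv := !![1, -a; 0, 1]
  val_inv := by simp [Matrix.one_fin_two]
  inv_val := by simp [Matrix.one_fin_two]

/-- The matrix `(1 0; a 1)`. -/
noncomputable def lowerUnipotent (a : Fq[X]) : Matrix.GeneralLinearGroup (Fin 2) Fq[X] where
  val := !![1, 0; a, 1]
  inv := !![1, 0; -a, 1]
  val_inv := by simp [Matrix.one_fin_two]
  inv_val := by simp [Matrix.one_fin_two]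

/-- Translations are the case `c = 0` of the transformation law, so every element of `A` is a
period. -/
theorem isPeriodicAnalytic_falseEisenstein (π : CInfty Fq) :
    IsPeriodicAnalytic (falseEisenstein π) := by
  refine ⟨isRigidAnalytic_falseEisenstein π, ⊤, top_ne_bot, fun a _ z w hw => ?_⟩
  have h10 : entry (polyGL Fq (upperUnipotent a)) 1 0 = 0 := map_zero polyToC
  have h00 : entry (polyGL Fq (upperUnipotent a)) 0 0 = 1 := map_one polyToC
  have h11 : entry (polyGL Fq (upperUnipotent a)) 1 1 = 1 := map_one polyToC
  have h01 : entry (polyGL Fq (upperUnipotent a)) 0 1 = polyToC a := rfl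
  have hj : autFactor (polyGL Fq (upperUnipotent a)) z = 1 := by
    rw [autFactor, h10, h11]; ring
  have hd : detC (polyGL Fq (upperUnipotent a)) = 1 := by
    rw [detC_eq, h00, h01, h10, h11]; ring
  have hm : mobius (polyGL Fq (upperUnipotent a)) z = w := by
    apply Subtype.ext
    rw [coe_mobius, hj, h00, h01, hw]
    ring
  have := slash_falseEisenstein π (upperUnipotent a) z
  rw [slash, ← detC, hd, hj, hm, h10] at this
  simpa using this

theorem norm_eisensteinSum_le (z : Omega Fq) {R : ℝ} (hR : 0 < R)
    (hz : R ≤ imagAbs (z : CInfty Fq)) : ‖eisensteinSum z‖ ≤ R⁻¹ := by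
  have : Nonempty {a : Fq[X] // a.Monic} := ⟨⟨1, Polynomial.monic_one⟩⟩
  refine IsUltrametricDist.norm_tsum_le_of_forall_le fun a =>
    IsUltrametricDist.norm_tsum_le_of_forall_le fun b => ?_
  have h := mul_imagAbs_le (z : CInfty Fq)
    (algebraMap (RatFunc Fq) (KInfty Fq) (algebraMap Fq[X] (RatFunc Fq) a))
    (algebraMap (RatFunc Fq) (KInfty Fq) (algebraMap Fq[X] (RatFunc Fq) b))
  rw [← norm_kInftyToC, ← polyToC_eq, ← polyToC_eq] at h
  have hne : latticePoint z ((a : Fq[X]), b) ≠ 0 :=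
    latticePoint_ne_zero z fun h => a.2.ne_zero (congrArg Prod.fst h)
  rw [latticeTerm, norm_div, div_le_iff₀ (norm_pos_iff.2 hne), inv_mul_eq_div, le_div_iff₀ hR]
  exact (mul_le_mul_of_nonneg_left hz (norm_nonneg _)).trans h

/-! ### The cocycle property of the slash operator -/

theorem entry_mul (γ δ : GL2KInfty Fq) (i j : Fin 2) :
    entry (γ * δ) i j = entry γ i 0 * entry δ 0 j + entry γ i 1 * entry δ 1 j := by
  have : (γ * δ) i j = γ i 0 * δ 0 j + γ i 1 * δ 1 j := by
    rw [Matrix.GeneralLinearGroup.coe_mul, Matrix.mul_apply, Fin.sum_univ_two]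
  rw [entry, this, map_add, map_mul, map_mul]
  rfl

theorem detC_mul (γ δ : GL2KInfty Fq) : detC (γ * δ) = detC γ * detC δ := by
  simp only [detC, map_mul, Units.val_mul]

theorem autFactor_mul (γ δ : GL2KInfty Fq) (z : Omega Fq) :
    autFactor (γ * δ) z = autFactor γ (mobius δ z) * autFactor δ z := by
  have hj := autFactor_ne_zero δ z
  rw [autFactor, autFactor, coe_mobius, add_mul, mul_assoc, div_mul_cancel₀ _ hj]
  simp only [autFactor, entry_mul]
  ring

theorem mobius_mul (γ δ : GL2KInfty Fq) (z : Omega Fq) :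
    mobius (γ * δ) z = mobius γ (mobius δ z) := by
  apply Subtype.ext
  have hj := autFactor_ne_zero δ z
  rw [coe_mobius, coe_mobius γ, autFactor_mul, mul_comm (autFactor γ _), ← div_div]
  congr 1
  rw [div_eq_iff hj, add_mul (entry γ 0 0 * _), coe_mobius, mul_assoc, div_mul_cancel₀ _ hj]
  simp only [autFactor, entry_mul]
  ring

theorem slash_apply (k m : ℤ) (f : Omega Fq → CInfty Fq) (γ : GL2KInfty Fq) (z : Omega Fq) :
    slash k m f γ z = detC γ ^ m * autFactor γ z ^ (-k) * f (mobius γ z) := rfl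

theorem slash_mul (k m : ℤ) (f : Omega Fq → CInfty Fq) (γ δ : GL2KInfty Fq) :
    slash k m f (γ * δ) = slash k m (slash k m f γ) δ := by
  funext z
  simp only [slash_apply, detC_mul, autFactor_mul, mobius_mul, mul_zpow]
  ring

theorem slash_mul_fun (k k' m m' : ℤ) (f g : Omega Fq → CInfty Fq) (γ : GL2KInfty Fq) :
    slash (k + k') (m + m') (f * g) γ = slash k m f γ * slash k' m' g γ := by
  funext z
  simp only [slash_apply, Pi.mul_apply]
  rw [zpow_add₀ (detC_ne_zero γ), neg_add, zpow_add₀ (autFactor_ne_zero γ z)]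
  ring

theorem slash_zero_zero_one (γ : GL2KInfty Fq) : slash 0 0 (1 : Omega Fq → CInfty Fq) γ = 1 := by
  funext z
  simp [slash_apply]

theorem slash_pow (k m : ℤ) (f : Omega Fq → CInfty Fq) (γ : GL2KInfty Fq) (n : ℕ) :
    slash (n * k) (n * m) (f ^ n) γ = slash k m f γ ^ n := by
  induction n with
  | zero => simpa using slash_zero_zero_one γ
  | succ n ih =>
    rw [pow_succ, pow_succ, ← ih, ← slash_mul_fun]
    push_cast
    rw [add_mul, add_mul, one_mul, one_mul]

/-- The function `X_γ(z) = c / (c z + d)`. -/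
noncomputable def cocycleX (γ : GL2KInfty Fq) (z : Omega Fq) : CInfty Fq :=
  entry γ 1 0 / autFactor γ z

/-- `X_γ` is the logarithmic derivative of `cz + d`, and `z ↦ δz` has derivative `det δ / (autFactor
δ z)^2`: this is the logarithmic derivative of `autFactor_mul`. -/
theorem cocycleX_mul (γ δ : GL2KInfty Fq) (z : Omega Fq) :
    cocycleX (γ * δ) z =
      cocycleX δ z + detC δ / autFactor δ z ^ 2 * cocycleX γ (mobius δ z) := by
  have hj := autFactor_ne_zero δ z
  have hj' := autFactor_ne_zero γ (mobius δ z)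
  have h : autFactor γ (mobius δ z) * autFactor δ z =
      entry γ 1 0 * (entry δ 0 0 * z + entry δ 0 1) + entry γ 1 1 * autFactor δ z := by
    rw [autFactor, coe_mobius, add_mul, mul_assoc, div_mul_cancel₀ _ hj]
  rw [cocycleX, cocycleX, cocycleX, autFactor_mul, entry_mul, detC_eq]
  have e : autFactor δ z = entry δ 1 0 * z + entry δ 1 1 := rfl
  field_simp
  linear_combination (-entry δ 1 0) * h + (entry γ 1 0 * entry δ 0 0) * e

/-! ### Uniqueness of associated polynomials -/

/-- `Γ` contains the lower unipotent matrices with entry in the ideal `I`, and `x ↦ x/(xz+1)` is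
injective. -/
theorem infinite_cocycleX {Γ : Subgroup (GL2K Fq)} (hΓ : IsArithmeticCongruence Γ)
    (z : Omega Fq) : {x | ∃ γ ∈ Γ, cocycleX (toGL2KInfty γ) z = x}.Infinite := by
  obtain ⟨-, I, hI, hIΓ⟩ := hΓ
  obtain ⟨a, ha, ha0⟩ := Submodule.exists_mem_ne_zero_of_ne_bot hI
  have hmem (b : Fq[X]) : Matrix.GeneralLinearGroup.map (algebraMap Fq[X] (RatFunc Fq))
      (lowerUnipotent (a * b)) ∈ Γ := by
    refine hIΓ (Subgroup.mem_map_of_mem _ ?_)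
    rw [MonoidHom.mem_ker]
    ext i j
    have h0 : Ideal.Quotient.mk I (a * b) = 0 :=
      Ideal.Quotient.eq_zero_iff_mem.2 (I.mul_mem_right b ha)
    fin_cases i <;> fin_cases j <;>
      simp [lowerUnipotent, Matrix.GeneralLinearGroup.map_apply, h0, -map_mul]
  have hval (b : Fq[X]) : cocycleX (polyGL Fq (lowerUnipotent (a * b))) z =
      polyToC (a * b) / (polyToC (a * b) * z + 1) := by
    have h11 : entry (polyGL Fq (lowerUnipotent (a * b))) 1 1 = 1 := map_one polyToC
    have h10 : entry (polyGL Fq (lowerUnipotent (a * b))) 1 0 = polyToC (a * b) := rfl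
    rw [cocycleX, autFactor, h10, h11]
  have hinj : Function.Injective fun b : Fq[X] =>
      cocycleX (polyGL Fq (lowerUnipotent (a * b))) z := by
    intro b b' h
    dsimp only at h
    have hne (b : Fq[X]) : polyToC (a * b) * (z : CInfty Fq) + 1 ≠ 0 := by
      have := latticePoint_ne_zero z (v := (a * b, 1)) (fun h => one_ne_zero (congrArg Prod.snd h))
      simpa [latticePoint] using this
    rw [hval, hval, div_eq_div_iff (hne b) (hne b')] at h
    have h' : polyToC (a * b) = polyToC (a * b') := by linear_combination h
    exact mul_left_cancel₀ ha0 (polyToC_injective h')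
  refine (Set.infinite_range_of_injective hinj).mono ?_
  rintro _ ⟨b, rfl⟩
  exact ⟨_, hmem b, rfl⟩

theorem coeff_eq_of_infinite {S : Set (CInfty Fq)} (hS : S.Infinite) {ℓ : ℕ}
    {c d : ℕ → CInfty Fq} (h : ∀ x ∈ S, ∑ i ∈ Finset.range (ℓ + 1), c i * x ^ i =
      ∑ i ∈ Finset.range (ℓ + 1), d i * x ^ i) : ∀ i ≤ ℓ, c i = d i := by
  have := Polynomial.eq_of_infinite_eval_eq
    (∑ i ∈ Finset.range (ℓ + 1), Polynomial.C (c i) * Polynomial.X ^ i)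
    (∑ i ∈ Finset.range (ℓ + 1), Polynomial.C (d i) * Polynomial.X ^ i)
    (hS.mono fun x hx => by simpa [Polynomial.eval_finsetSum] using h x hx)
  intro i hi
  have h1 := congrArg (fun p => p.coeff i) this
  simpa [Polynomial.finsetSum_coeff, Polynomial.coeff_C_mul, Polynomial.coeff_X_pow,
    Nat.lt_succ_of_le hi] using h1

/-! ### Boundedness on vertical lines -/

theorem IsBoundedVertically.mul {f g : Omega Fq → CInfty Fq} (hf : IsBoundedVertically f)
    (hg : IsBoundedVertically g) : IsBoundedVertically (f * g) := by
  obtain ⟨C, R, h⟩ := hf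
  obtain ⟨C', R', h'⟩ := hg
  refine ⟨|C| * |C'|, max R R', fun z hz => ?_⟩
  rw [Pi.mul_apply, norm_mul]
  exact mul_le_mul ((h z ((le_max_left _ _).trans hz)).trans (le_abs_self C))
    ((h' z ((le_max_right _ _).trans hz)).trans (le_abs_self C')) (norm_nonneg _) (abs_nonneg _)

theorem IsBoundedVertically.pow {f : Omega Fq → CInfty Fq} (hf : IsBoundedVertically f) (n : ℕ) :
    IsBoundedVertically (f ^ n) := by
  induction n with
  | zero => exact ⟨1, 0, fun z _ => by simp⟩
  | succ n ih => rw [pow_succ]; exact ih.mul hf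

/-- Boundedness on vertical lines is preserved by upper triangular matrices. -/
theorem IsBoundedVertically.slash {f : Omega Fq → CInfty Fq} (hf : IsBoundedVertically f)
    (k m : ℤ) {γ : GL2KInfty Fq} (hγ : γ 1 0 = 0) :
    IsBoundedVertically (slash k m f γ) := by
  obtain ⟨C, R, h⟩ := hf
  have hdet := det_ne_zero γ
  rw [hγ, mul_zero, sub_zero] at hdet
  have ha : γ 0 0 ≠ 0 := left_ne_zero_of_mul hdet
  have hd : γ 1 1 ≠ 0 := right_ne_zero_of_mul hdet
  have hj (z : Omega Fq) : autFactor γ z = entry γ 1 1 := by simp [autFactor, entry, hγ]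
  have hρ : 0 < ‖γ 0 0 / γ 1 1‖ := norm_pos_iff.2 (div_ne_zero ha hd)
  refine ⟨‖detC γ ^ m * entry γ 1 1 ^ (-k)‖ * C, R / ‖γ 0 0 / γ 1 1‖, fun z hz => ?_⟩
  rw [slash_apply, hj, norm_mul]
  refine mul_le_mul_of_nonneg_left (h _ ?_) (norm_nonneg _)
  refine le_ciInf fun x => ?_
  have hd' : kInftyToC (γ 1 1) ≠ 0 := by simpa using hd
  -- An upper triangular matrix is an affine map over `K_∞`, which scales the imaginary part by `‖γ
  -- 0 0 / γ 1 1‖`.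
  have e : (mobius γ z : CInfty Fq) - kInftyToC x =
      kInftyToC (γ 0 0 / γ 1 1) * z + kInftyToC (γ 0 1 / γ 1 1 - x) := by
    rw [coe_mobius, hj]
    simp only [entry, map_div₀, map_sub]
    field_simp
    ring
  rw [e]
  rw [div_le_iff₀ hρ, mul_comm] at hz
  exact hz.trans (mul_imagAbs_le _ _ _)

theorem isBoundedVertically_falseEisenstein (π : CInfty Fq) :
    IsBoundedVertically (falseEisenstein π) := by
  refine ⟨‖π⁻¹‖ * 1⁻¹, 1, fun z hz => ?_⟩
  rw [falseEisenstein_eq, norm_mul]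
  exact mul_le_mul_of_nonneg_left (norm_eisensteinSum_le z one_pos hz) (norm_nonneg _)

theorem isBoundedVertically_cocycleX (γ : GL2KInfty Fq) : IsBoundedVertically (cocycleX γ) := by
  refine ⟨1, 1, fun z hz => ?_⟩
  rw [cocycleX, norm_div, div_le_one (norm_pos_iff.2 (autFactor_ne_zero γ z))]
  have := mul_imagAbs_le (z : CInfty Fq) (γ 1 0) (γ 1 1)
  rw [← norm_kInftyToC] at this
  exact (le_mul_of_one_le_right (norm_nonneg _) hz).trans this

/-- A matrix in `GL₂(A)` whose first column is a given pair of coprime polynomials. -/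
noncomputable def bezoutGL {x y s t : Fq[X]} (h : s * x + t * y = 1) :
    Matrix.GeneralLinearGroup (Fin 2) Fq[X] where
  val := !![x, -t; y, s]
  inv := !![s, t; -y, x]
  val_inv := by
    rw [Matrix.mul_fin_two, Matrix.one_fin_two]
    congr! <;> first | ring1 | linear_combination h
  inv_val := by
    rw [Matrix.mul_fin_two, Matrix.one_fin_two]
    congr! <;> first | ring1 | linear_combination h

theorem bezoutGL_inv_one_zero {x y s t : Fq[X]} (h : s * x + t * y = 1) :
    (bezoutGL h)⁻¹ 1 0 = -y := rfl

theorem bezoutGL_inv_one_one {x y s t : Fq[X]} (h : s * x + t * y = 1) :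
    (bezoutGL h)⁻¹ 1 1 = x := rfl

/-- `GL₂(K)` is the product of `GL₂(A)` and the upper triangular matrices. -/
theorem exists_eq_map_mul_upper (γ : GL2K Fq) :
    ∃ (g : Matrix.GeneralLinearGroup (Fin 2) Fq[X]) (u : GL2K Fq),
      γ = Matrix.GeneralLinearGroup.map (algebraMap Fq[X] (RatFunc Fq)) g * u ∧ u 1 0 = 0 := by
  by_cases hc : γ 1 0 = 0
  · exact ⟨1, γ, by simp, hc⟩
  -- `r` is the image of the cusp `∞` under `γ`. A matrix of `GL₂(A)` with first column `(num r,
  -- denom r)` sends `∞` to the same cusp, so the quotient fixes `∞`.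
  set r := γ 0 0 / γ 1 0 with hr
  obtain ⟨s, t, hst⟩ := RatFunc.isCoprime_num_denom r
  refine ⟨bezoutGL hst, (Matrix.GeneralLinearGroup.map (algebraMap Fq[X] (RatFunc Fq))
    (bezoutGL hst))⁻¹ * γ, (mul_inv_cancel_left _ _).symm, ?_⟩
  rw [← map_inv, Matrix.GeneralLinearGroup.coe_mul, Matrix.mul_apply, Fin.sum_univ_two,
    Matrix.GeneralLinearGroup.map_apply, Matrix.GeneralLinearGroup.map_apply,
    bezoutGL_inv_one_zero, bezoutGL_inv_one_one, map_neg]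
  have hden : algebraMap Fq[X] (RatFunc Fq) r.denom ≠ 0 := by
    simpa using r.denom_ne_zero
  have hrr := RatFunc.num_div_denom r
  rw [hr, div_eq_div_iff (hr ▸ hden) hc, ← hr] at hrr
  linear_combination hrr

/-- All cusps are equivalent under `GL₂(A)`. For `g` there, `E|g` is `E` minus a multiple of `X_g`,
both bounded, and the remaining upper triangular factor preserves boundedness. -/
theorem isBoundedVertically_slash_falseEisenstein (π : CInfty Fq) (γ : GL2K Fq) :
    IsBoundedVertically (slash 2 1 (falseEisenstein π) (toGL2KInfty γ)) := by
  obtain ⟨g, u, rfl, hu⟩ := exists_eq_map_mul_upper γ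
  rw [map_mul, slash_mul]
  have hu' : toGL2KInfty u 1 0 = 0 := by
    change algebraMap (RatFunc Fq) (KInfty Fq) (u 1 0) = 0
    rw [hu, map_zero]
  refine IsBoundedVertically.slash ?_ 2 1 hu'
  have e : slash 2 1 (falseEisenstein π) (polyGL Fq g) =
      falseEisenstein π + (-π⁻¹) • cocycleX (polyGL Fq g) := by
    funext z
    rw [slash_falseEisenstein, Pi.add_apply, Pi.smul_apply, smul_eq_mul, neg_mul, ← sub_eq_add_neg]
    rfl
  change IsBoundedVertically (slash 2 1 (falseEisenstein π) (polyGL Fq g))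
  rw [e]
  exact (isBoundedVertically_falseEisenstein π).add ((isBoundedVertically_cocycleX _).smul _)

/-! ### Modular functions and forms -/

/-- Modular functions of weight `k` and type `m`, with holomorphy at the cusps if `P` holds: for
`P` false these are the modular functions, for `P` true the modular forms. -/
def IsModular (P : Prop) (Γ : Subgroup (GL2K Fq)) (k m : ℤ) (g : Omega Fq → CInfty Fq) : Prop :=
  IsPeriodicAnalytic g ∧ (∀ γ ∈ Γ, slash k m g (toGL2KInfty γ) = g) ∧
    (P → ∀ γ, IsBoundedVertically (slash k m g (toGL2KInfty γ)))

/-- Quasi-modular functions of depth at most `ℓ`, with holomorphy at the cusps if `P` holds. -/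
def IsQuasiModular (P : Prop) (Γ : Subgroup (GL2K Fq)) (k m : ℤ) (ℓ : ℕ)
    (f : Omega Fq → CInfty Fq) : Prop :=
  ∃ c, IsAssociated Γ k m ℓ f c ∧ (P → IsHolomorphicAtCusps k m ℓ c)

section

variable {P : Prop} {Γ : Subgroup (GL2K Fq)} {k m : ℤ} {ℓ : ℕ} {f g : Omega Fq → CInfty Fq}
  {c : ℕ → Omega Fq → CInfty Fq}

theorem mem_QMFun_iff : f ∈ QMFun Γ k m ℓ ↔ IsQuasiModular False Γ k m ℓ f := by
  simp only [IsQuasiModular, false_imp_iff, and_true]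
  exact exists_qmFunDepth_iff

theorem mem_QMForm_iff : f ∈ QMForm Γ k m ℓ ↔ IsQuasiModular True Γ k m ℓ f := by
  simp only [IsQuasiModular, true_imp_iff]
  exact exists_qmFormDepth_iff

theorem isQuasiModular_zero_iff : IsQuasiModular P Γ k m 0 g ↔ IsModular P Γ k m g := by
  constructor
  · rintro ⟨c, h, hP⟩
    obtain rfl := h.eq_zeroth
    refine ⟨h.1 0 le_rfl, fun γ hγ => ?_, fun hp γ => ?_⟩
    · funext z
      rw [h.2 γ hγ]
      simp
    · simpa using hP hp 0 le_rfl γ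
  · rintro ⟨h1, h2, h3⟩
    refine ⟨fun _ => g, ⟨fun _ _ => h1, fun γ hγ z => ?_⟩, fun hp i hi γ => ?_⟩
    · rw [h2 γ hγ]
      simp
    · obtain rfl : i = 0 := by omega
      simpa using h3 hp γ

theorem mem_MFun_iff : g ∈ MFun Γ k m ↔ IsModular False Γ k m g :=
  mem_QMFun_iff.trans isQuasiModular_zero_iff

theorem mem_MForm_iff : g ∈ MForm Γ k m ↔ IsModular True Γ k m g :=
  mem_QMForm_iff.trans isQuasiModular_zero_iff

theorem IsModular.smul (h : IsModular P Γ k m g) (a : CInfty Fq) : IsModular P Γ k m (a • g) :=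
  ⟨h.1.smul a, fun γ hγ => by rw [slash_smul, h.2.1 γ hγ],
    fun hp γ => by rw [slash_smul]; exact (h.2.2 hp γ).smul a⟩

/-- The top coefficient of an associated polynomial is modular. -/
theorem IsAssociated.isModular_top (hΓ : IsArithmeticCongruence Γ)
    (h : IsAssociated Γ k m ℓ f c) (hP : P → IsHolomorphicAtCusps k m ℓ c) :
    IsModular P Γ (k - 2 * ℓ) (m - ℓ) (c ℓ) := by
  refine ⟨h.1 ℓ le_rfl, fun δ hδ => ?_, fun hp γ => hP hp ℓ le_rfl γ⟩
  funext z
  have hj := autFactor_ne_zero (toGL2KInfty δ) z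
  have hd := detC_ne_zero (toGL2KInfty δ)
  set w := mobius (toGL2KInfty δ) z with hw
  -- Evaluated at `X_γ(w)`, both sides compute `f|γδ` at `z`. As `γ` varies in `Γ` these points are
  -- infinite in number, so the polynomials agree.
  have hpoly : ∑ i ∈ Finset.range (ℓ + 1), Polynomial.C (c i z) *
        (Polynomial.C (detC (toGL2KInfty δ) / autFactor (toGL2KInfty δ) z ^ 2) * Polynomial.X +
          Polynomial.C (cocycleX (toGL2KInfty δ) z)) ^ i =
      ∑ i ∈ Finset.range (ℓ + 1), Polynomial.C (detC (toGL2KInfty δ) ^ m *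
        autFactor (toGL2KInfty δ) z ^ (-k) * c i w) * Polynomial.X ^ i := by
    refine Polynomial.eq_of_infinite_eval_eq _ _ ((infinite_cocycleX hΓ w).mono ?_)
    rintro _ ⟨γ, hγ, rfl⟩
    have h1 := h.2 (γ * δ) (Γ.mul_mem hγ hδ) z
    rw [map_mul, slash_mul, slash_apply, ← hw, h.2 γ hγ w] at h1
    simp only [Set.mem_ofPred_eq, Polynomial.eval_finsetSum, Polynomial.eval_mul,
      Polynomial.eval_C, Polynomial.eval_pow, Polynomial.eval_add, Polynomial.eval_X]
    change _ * ∑ i ∈ Finset.range (ℓ + 1), c i w * cocycleX (toGL2KInfty γ) w ^ i =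
      ∑ i ∈ Finset.range (ℓ + 1), c i z *
        cocycleX (toGL2KInfty γ * toGL2KInfty δ) z ^ i at h1
    rw [cocycleX_mul, ← hw] at h1
    rw [Finset.sum_congr rfl fun i _ => mul_assoc _ (c i w) _, ← Finset.mul_sum, h1]
    exact Finset.sum_congr rfl fun i _ => by rw [add_comm (cocycleX _ z)]
  -- On the left, the terms with `i < ℓ` have degree below `ℓ`, so only `c_ℓ(z) (det δ / j^2)^ℓ`
  -- survives, with `j` the automorphy factor of `δ`.
  have hcoeff := congrArg (fun p => p.coeff ℓ) hpoly
  simp only [Polynomial.finsetSum_coeff, Polynomial.coeff_C_mul, Polynomial.coeff_X_pow] at hcoeff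
  rw [Finset.sum_eq_single_of_mem ℓ (Finset.self_mem_range_succ ℓ) fun i hi hne => ?_,
    Finset.sum_eq_single_of_mem ℓ (Finset.self_mem_range_succ ℓ) fun i _ hne => by
      rw [if_neg hne.symm, mul_zero]] at hcoeff
  · have h2 := Polynomial.coeff_pow_of_natDegree_le (m := ℓ)
      (Polynomial.natDegree_linear_le
        (a := detC (toGL2KInfty δ) / autFactor (toGL2KInfty δ) z ^ 2)
        (b := cocycleX (toGL2KInfty δ) z))
    rw [mul_one] at h2
    rw [h2] at hcoeff
    simp only [Polynomial.coeff_add, Polynomial.coeff_C_mul, Polynomial.coeff_X_one, mul_one,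
      Polynomial.coeff_C_succ, add_zero, if_true, div_pow] at hcoeff
    rw [slash_apply, ← hw, neg_sub, zpow_sub₀ hd, zpow_sub₀ hj, zpow_natCast]
    rw [zpow_neg] at hcoeff
    have e : autFactor (toGL2KInfty δ) z ^ (2 * (ℓ : ℤ)) = (autFactor (toGL2KInfty δ) z ^ 2) ^ ℓ := by
      rw [← pow_mul, ← zpow_natCast]
      push_cast
      rfl
    rw [e]
    have hk : autFactor (toGL2KInfty δ) z ^ k ≠ 0 := zpow_ne_zero _ hj
    generalize autFactor (toGL2KInfty δ) z ^ k = J at *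
    generalize autFactor (toGL2KInfty δ) z = j at *
    field_simp at hcoeff ⊢
    linear_combination -hcoeff
  · have hi' : i < ℓ := lt_of_le_of_ne (Nat.lt_succ_iff.1 (Finset.mem_range.1 hi)) hne
    rw [Polynomial.coeff_eq_zero_of_natDegree_lt, mul_zero]
    exact (Polynomial.natDegree_pow_le_of_le i Polynomial.natDegree_linear_le).trans_lt (by omega)

theorem slash_mul_falseEisenstein_pow (k m : ℤ) (π : CInfty Fq) (g : Omega Fq → CInfty Fq)
    (i : ℕ) (γ : GL2KInfty Fq) :
    slash (k + i * 2) (m + i * 1) (g * falseEisenstein π ^ i) γ =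
      slash k m g γ * slash 2 1 (falseEisenstein π) γ ^ i := by
  rw [slash_mul_fun, slash_pow]

theorem IsModular.slash_mul_pow {i : ℕ} (h : IsModular P Γ (k - 2 * i) (m - i) g)
    (hΓA : Γ ≤ GL2A Fq) (π : CInfty Fq) {γ : GL2K Fq} (hγ : γ ∈ Γ) (z : Omega Fq) :
    slash k m (g * falseEisenstein π ^ i) (toGL2KInfty γ) z =
      g z * (falseEisenstein π z - π⁻¹ * cocycleX (toGL2KInfty γ) z) ^ i := by
  obtain ⟨a, rfl⟩ := hΓA hγ
  have e := slash_mul_falseEisenstein_pow (k - 2 * i) (m - i) π g i (polyGL Fq a)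
  rw [show k - 2 * (i : ℤ) + i * 2 = k by ring, show m - (i : ℤ) + i * 1 = m by ring] at e
  refine (congrFun e z).trans ?_
  have h1 : slash (k - 2 * i) (m - i) g (polyGL Fq a) = g := h.2.1 _ hγ
  rw [h1, Pi.mul_apply, Pi.pow_apply, slash_falseEisenstein]
  rfl

/-- The coefficients of the polynomial associated with `g E ^ i`. -/
noncomputable def powCoeff (π : CInfty Fq) (g : Omega Fq → CInfty Fq) (i j : ℕ) :
    Omega Fq → CInfty Fq :=
  ((i.choose j : CInfty Fq) * (-π⁻¹) ^ j) • (g * falseEisenstein π ^ (i - j))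

theorem IsModular.isAssociated {i : ℕ} (h : IsModular P Γ (k - 2 * i) (m - i) g)
    (hΓA : Γ ≤ GL2A Fq) (π : CInfty Fq) :
    IsAssociated Γ k m i (g * falseEisenstein π ^ i) (powCoeff π g i) := by
  refine ⟨fun j _ => (h.1.mul ((isPeriodicAnalytic_falseEisenstein π).pow _)).smul _,
    fun γ hγ z => ?_⟩
  rw [h.slash_mul_pow hΓA π hγ, sub_eq_neg_add, add_pow, Finset.mul_sum]
  refine Finset.sum_congr rfl fun j _ => ?_
  simp only [powCoeff, Pi.smul_apply, Pi.mul_apply, Pi.pow_apply, smul_eq_mul]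
  rw [← cocycleX, ← neg_mul, mul_pow]
  ring

/-- The weights match: `(k - 2i) + 2(i - j) = k - 2j`, so the slash splits into those of `g` and of
`E`, each bounded. -/
theorem IsModular.isHolomorphicAtCusps {i : ℕ} (h : IsModular P Γ (k - 2 * i) (m - i) g)
    (π : CInfty Fq) (hp : P) : IsHolomorphicAtCusps k m i (powCoeff π g i) := by
  intro j hj γ
  rw [powCoeff, slash_smul]
  have e := slash_mul_falseEisenstein_pow (k - 2 * i) (m - i) π g (i - j) (toGL2KInfty γ)
  rw [Nat.cast_sub hj, show k - 2 * (i : ℤ) + (i - j) * 2 = k - 2 * j by ring,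
    show m - (i : ℤ) + (i - j) * 1 = m - j by ring] at e
  rw [e]
  exact ((h.2.2 hp γ).mul ((isBoundedVertically_slash_falseEisenstein π γ).pow _)).smul _

theorem IsModular.isQuasiModular {i : ℕ} (hi : i ≤ ℓ)
    (h : IsModular P Γ (k - 2 * i) (m - i) g) (hΓA : Γ ≤ GL2A Fq) (π : CInfty Fq) :
    IsQuasiModular P Γ k m ℓ (g * falseEisenstein π ^ i) :=
  ⟨_, (h.isAssociated hΓA π).pad hi, fun hp => (h.isHolomorphicAtCusps π hp).pad⟩

theorem IsAssociated.of_top_eq_zero (h : IsAssociated Γ k m (ℓ + 1) f c) (h0 : c (ℓ + 1) = 0) :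
    IsAssociated Γ k m ℓ f c :=
  ⟨fun i hi => h.1 i (hi.trans ℓ.le_succ), fun γ hγ z => by
    rw [h.2 γ hγ, Finset.sum_range_succ, h0]
    simp⟩

/-- Every quasi-modular function is a polynomial in `E` with modular coefficients. -/
theorem IsAssociated.exists_eq_sum (hΓ : IsArithmeticCongruence Γ) (hΓA : Γ ≤ GL2A Fq)
    {π : CInfty Fq} (hπ : π ≠ 0) (h : IsAssociated Γ k m ℓ f c)
    (hP : P → IsHolomorphicAtCusps k m ℓ c) :
    ∃ g : ℕ → Omega Fq → CInfty Fq, (∀ i ≤ ℓ, IsModular P Γ (k - 2 * i) (m - i) (g i)) ∧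
      f = ∑ i ∈ Finset.range (ℓ + 1), g i * falseEisenstein π ^ i ∧ g ℓ = (-π) ^ ℓ • c ℓ := by
  induction ℓ generalizing f c with
  | zero =>
    refine ⟨c, fun i hi => ?_, by simpa using h.eq_zeroth, by simp⟩
    obtain rfl : i = 0 := by omega
    exact h.isModular_top hΓ hP
  | succ n ih =>
    have hG := (h.isModular_top hΓ hP).smul ((-π) ^ (n + 1))
    -- The factor cancels the top coefficient `(-π⁻¹)^(n+1)` contributed by `E^(n+1)`, so `f - G
    -- E^(n+1)` has depth at most `n`.
    set G := (-π) ^ (n + 1) • c (n + 1) with hGdef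
    have h1 := h.add ((hG.isAssociated hΓA π).smul (-1))
    have htop : (c + (-1 : CInfty Fq) • powCoeff π G (n + 1)) (n + 1) = 0 := by
      rw [Pi.add_apply, Pi.smul_apply, powCoeff, Nat.choose_self, Nat.sub_self, pow_zero, mul_one,
        hGdef, smul_smul, smul_smul, Nat.cast_one, one_mul, mul_assoc, ← mul_pow, neg_mul_neg,
        inv_mul_cancel₀ hπ, one_pow, mul_one, neg_one_smul, add_neg_cancel]
    have h2 (hp : P) := (hP hp).add ((hG.isHolomorphicAtCusps π hp).smul (-1))
    obtain ⟨g, hg, hsum, -⟩ := ih (h1.of_top_eq_zero htop)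
      fun hp i hi γ => h2 hp i (hi.trans n.le_succ) γ
    refine ⟨Function.update g (n + 1) G, fun i hi => ?_, ?_, Function.update_self _ _ _⟩
    · by_cases hin : i = n + 1
      · subst hin
        rw [Function.update_self]
        exact hG
      · rw [Function.update_of_ne hin]
        exact hg i (by omega)
    · rw [Finset.sum_range_succ, Function.update_self, Finset.sum_congr rfl fun i hi => by
        rw [Function.update_of_ne (Finset.mem_range.1 hi).ne], ← hsum, neg_one_smul,
        neg_add_cancel_right]

/-- Powers of `E` are linearly independent over the modular functions. -/
theorem eq_zero_of_sum_eq_zero (hΓ : IsArithmeticCongruence Γ) (hΓA : Γ ≤ GL2A Fq)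
    {π : CInfty Fq} (hπ : π ≠ 0) {g : ℕ → Omega Fq → CInfty Fq}
    (hg : ∀ i ≤ ℓ, IsModular P Γ (k - 2 * i) (m - i) (g i))
    (h : ∑ i ∈ Finset.range (ℓ + 1), g i * falseEisenstein π ^ i = 0) : ∀ i ≤ ℓ, g i = 0 := by
  intro i hi
  funext z
  -- The polynomial with coefficients `g_i(z)` vanishes at every `E(z) - π⁻¹ X_γ(z)`; injectivity
  -- keeps this set of zeros infinite.
  have hinj : Function.Injective fun x => falseEisenstein π z - π⁻¹ * x := fun x y hxy =>
    mul_left_cancel₀ (inv_ne_zero hπ) (sub_right_injective hxy)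
  refine coeff_eq_of_infinite ((infinite_cocycleX hΓ z).image hinj.injOn) (c := fun i => g i z)
    (d := 0) ?_ i hi
  rintro _ ⟨_, ⟨γ, hγ, rfl⟩, rfl⟩
  have h1 := congrArg (fun f => slash k m f (toGL2KInfty γ) z) h
  simp only [slash_zero] at h1
  have hs (s : Finset ℕ) (F : ℕ → Omega Fq → CInfty Fq) :
      slash k m (∑ i ∈ s, F i) (toGL2KInfty γ) z = ∑ i ∈ s, slash k m (F i) (toGL2KInfty γ) z := by
    simp only [slash_apply, Finset.sum_apply, Finset.mul_sum]
  rw [hs, Finset.sum_congr rfl fun i hi =>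
    (hg i (Nat.lt_succ_iff.1 (Finset.mem_range.1 hi))).slash_mul_pow hΓA π hγ z] at h1
  simpa using h1

end

/-! ### Direct sum decompositions -/

/-- Pure linear algebra, shared by functions and forms. Injectivity of multiplication by `E^i` on `W
i` is not assumed separately, being contained in `huniq`. -/
theorem decomposition_of_exists {V : Submodule (CInfty Fq) (Omega Fq → CInfty Fq)} {ℓ : ℕ}
    {W : ℕ → Submodule (CInfty Fq) (Omega Fq → CInfty Fq)} {E : Omega Fq → CInfty Fq}
    (hex : ∀ f ∈ V, ∃ g : ℕ → Omega Fq → CInfty Fq, (∀ i ≤ ℓ, g i ∈ W i) ∧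
      f = ∑ i ∈ Finset.range (ℓ + 1), g i * E ^ i)
    (hmem : ∀ i ≤ ℓ, ∀ g ∈ W i, g * E ^ i ∈ V)
    (huniq : ∀ g : ℕ → Omega Fq → CInfty Fq, (∀ i ≤ ℓ, g i ∈ W i) →
      ∑ i ∈ Finset.range (ℓ + 1), g i * E ^ i = 0 → ∀ i ≤ ℓ, g i = 0) :
    (iSupIndep fun i : Fin (ℓ + 1) => timesFun (W i) (E ^ (i : ℕ))) ∧
      V = (⨆ i : Fin (ℓ + 1), timesFun (W i) (E ^ (i : ℕ))) ∧
      (∀ f ∈ V, ∃! g : Fin (ℓ + 1) → Omega Fq → CInfty Fq,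
        (∀ i : Fin (ℓ + 1), g i ∈ W i) ∧ f = ∑ i, g i * E ^ (i : ℕ)) := by
  have huniq' (g : Fin (ℓ + 1) → Omega Fq → CInfty Fq) (hg : ∀ i : Fin (ℓ + 1), g i ∈ W i)
      (h : ∑ i, g i * E ^ (i : ℕ) = 0) : g = 0 := by
    have h1 := huniq (fun i => if hi : i < ℓ + 1 then g ⟨i, hi⟩ else 0) (fun i hi => by
      rw [dif_pos (Nat.lt_succ_of_le hi)]
      exact hg ⟨i, Nat.lt_succ_of_le hi⟩) (by
      rw [Finset.sum_range]
      refine (Finset.sum_congr rfl fun i _ => ?_).trans h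
      rw [dif_pos i.2])
    funext i
    have := h1 i (Nat.lt_succ_iff.1 i.2)
    rwa [dif_pos i.2] at this
  have hmap {i : ℕ} {g : Omega Fq → CInfty Fq} (hg : g ∈ W i) :
      g * E ^ i ∈ timesFun (W i) (E ^ i) := ⟨g, hg, rfl⟩
  refine ⟨?_, le_antisymm (fun f hf => ?_) (iSup_le fun i => ?_), fun f hf => ?_⟩
  · rw [iSupIndep_iff_finsetSum_eq_zero_imp_eq_zero]
    intro s v hv hsum i hi
    have hv' (j : Fin (ℓ + 1)) : ∃ g ∈ W j, g * E ^ (j : ℕ) = if j ∈ s then v j else 0 := by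
      split_ifs with hj
      · obtain ⟨g, hg, hgv⟩ := hv j hj
        exact ⟨g, hg, hgv⟩
      · exact ⟨0, zero_mem _, zero_mul _⟩
    choose g hg hgv using hv'
    have h0 := huniq' g hg (by
      rw [Finset.sum_congr rfl fun j _ => hgv j, Finset.sum_ite_mem, Finset.univ_inter, hsum])
    have := hgv i
    rw [if_pos hi, h0, Pi.zero_apply, zero_mul] at this
    exact this.symm
  · obtain ⟨g, hg, rfl⟩ := hex f hf
    rw [Finset.sum_range]
    exact Submodule.sum_mem _ fun i _ =>
      Submodule.mem_iSup_of_mem i (hmap (hg i (Nat.lt_succ_iff.1 i.2)))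
  · rintro _ ⟨g, hg, rfl⟩
    exact hmem i (Nat.lt_succ_iff.1 i.2) g hg
  · obtain ⟨g, hg, rfl⟩ := hex f hf
    refine ⟨fun i => g i, ⟨fun i => hg i (Nat.lt_succ_iff.1 i.2), Finset.sum_range _⟩,
      fun g' ⟨hg', hsum⟩ => ?_⟩
    rw [← sub_eq_zero]
    refine huniq' _ (fun i : Fin (ℓ + 1) => sub_mem (hg' i) (hg i (Nat.lt_succ_iff.1 i.2))) ?_
    rw [Finset.sum_range] at hsum
    simp only [Pi.sub_apply, sub_mul, Finset.sum_sub_distrib]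
    rw [hsum, sub_self]

/-! ### Application to quasi-modular functions and forms -/

section

variable {P : Prop} {Γ : Subgroup (GL2K Fq)} {k m : ℤ} {ℓ : ℕ} {f : Omega Fq → CInfty Fq}
  {c : ℕ → Omega Fq → CInfty Fq} {π : CInfty Fq}

theorem decomposition_of_isModular (hΓ : IsArithmeticCongruence Γ) (hΓA : Γ ≤ GL2A Fq)
    (hπ : π ≠ 0) {V : Submodule (CInfty Fq) (Omega Fq → CInfty Fq)}
    {W : ℕ → Submodule (CInfty Fq) (Omega Fq → CInfty Fq)}
    (hV : ∀ f, f ∈ V ↔ IsQuasiModular P Γ k m ℓ f)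
    (hW : ∀ i g, g ∈ W i ↔ IsModular P Γ (k - 2 * (i : ℕ)) (m - (i : ℕ)) g) :
    (iSupIndep fun i : Fin (ℓ + 1) => timesFun (W i) (falseEisenstein π ^ (i : ℕ))) ∧
      V = (⨆ i : Fin (ℓ + 1), timesFun (W i) (falseEisenstein π ^ (i : ℕ))) ∧
      (∀ f ∈ V, ∃! g : Fin (ℓ + 1) → Omega Fq → CInfty Fq,
        (∀ i : Fin (ℓ + 1), g i ∈ W i) ∧ f = ∑ i, g i * falseEisenstein π ^ (i : ℕ)) := by
  refine decomposition_of_exists (fun f hf => ?_) (fun i hi g hg => ?_) fun g hg h => ?_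
  · obtain ⟨c, hc, hP⟩ := (hV f).1 hf
    obtain ⟨g, hg, hfg, -⟩ := hc.exists_eq_sum hΓ hΓA hπ hP
    exact ⟨g, fun i hi => (hW i _).2 (hg i hi), hfg⟩
  · exact (hV _).2 (((hW i g).1 hg).isQuasiModular hi hΓA π)
  · exact eq_zero_of_sum_eq_zero hΓ hΓA hπ (fun i hi => (hW i _).1 (hg i hi)) h

/-- If the top coefficient of an associated polynomial of `f` is nonzero, then so is the top
coefficient of any expression of `f` as a polynomial in `E`. -/
theorem IsAssociated.exists_top_ne_zero (hΓ : IsArithmeticCongruence Γ) (hΓA : Γ ≤ GL2A Fq)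
    (hπ : π ≠ 0) (h : IsAssociated Γ k m ℓ f c) (hc : c ℓ ≠ 0) (hf : IsQuasiModular P Γ k m ℓ f) :
    ∃ g : Fin (ℓ + 1) → Omega Fq → CInfty Fq,
      (∀ i : Fin (ℓ + 1), IsModular P Γ (k - 2 * (i : ℕ)) (m - (i : ℕ)) (g i)) ∧
        f = ∑ i, g i * falseEisenstein π ^ (i : ℕ) ∧ g (Fin.last ℓ) ≠ 0 := by
  obtain ⟨c', hc', hP⟩ := hf
  obtain ⟨g, hg, hfg, -⟩ := hc'.exists_eq_sum hΓ hΓA hπ hP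
  -- The family `c` with nonzero top coefficient is not known to be holomorphic at the cusps. Its
  -- expansion is therefore compared with that of `c'` as modular functions, by linear independence.
  obtain ⟨g', hg', hfg', htop⟩ := h.exists_eq_sum (P := False) hΓ hΓA hπ False.elim
  refine ⟨fun i => g i, fun i => hg i (Nat.lt_succ_iff.1 i.2), hfg.trans (Finset.sum_range _), ?_⟩
  have hdiff := eq_zero_of_sum_eq_zero (P := False) (g := fun i => g' i + (-1 : CInfty Fq) • g i)
    hΓ hΓA hπ (fun i hi => ⟨(hg' i hi).1.add ((hg i hi).1.smul _), fun γ hγ => by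
      rw [slash_add, slash_smul, (hg' i hi).2.1 γ hγ, (hg i hi).2.1 γ hγ], False.elim⟩) (by
      simp only [neg_one_smul, ← sub_eq_add_neg, sub_mul, Finset.sum_sub_distrib]
      rw [← hfg, ← hfg', sub_self]) ℓ le_rfl
  rw [neg_one_smul, ← sub_eq_add_neg, sub_eq_zero] at hdiff
  change g ℓ ≠ 0
  rw [← hdiff, htop]
  exact smul_ne_zero (pow_ne_zero _ (neg_ne_zero.2 hπ)) hc

theorem exists_top_ne_zero_of_mem (hΓ : IsArithmeticCongruence Γ) (hΓA : Γ ≤ GL2A Fq)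
    (hπ : π ≠ 0) (hf : f ∈ QMFunDepth Γ k m ℓ) (hf0 : f ≠ 0) (hP : IsQuasiModular P Γ k m ℓ f) :
    ∃ g : Fin (ℓ + 1) → Omega Fq → CInfty Fq,
      (∀ i : Fin (ℓ + 1), IsModular P Γ (k - 2 * (i : ℕ)) (m - (i : ℕ)) (g i)) ∧
        f = ∑ i, g i * falseEisenstein π ^ (i : ℕ) ∧ g (Fin.last ℓ) ≠ 0 := by
  obtain ⟨-, ⟨h, -⟩ | ⟨c, hc, h⟩⟩ := hf
  · exact absurd h hf0
  · exact h.exists_top_ne_zero hΓ hΓA hπ hc hP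

end

end DrinfeldQM

theorem theorem3p3 {Fq : Type*} [Field Fq] [Finite Fq]
    (π : DrinfeldQM.CInfty Fq) (hπ : DrinfeldQM.IsCarlitzPeriod π)
    (Γ : Subgroup (DrinfeldQM.GL2K Fq)) (hΓ : DrinfeldQM.IsArithmeticCongruence Γ)
    (hΓA : Γ ≤ DrinfeldQM.GL2A Fq) (k ℓ : ℕ) (m : ℤ) :
    -- quasi-modular functions
    ((iSupIndep fun i : Fin (ℓ + 1) =>
        DrinfeldQM.timesFun (DrinfeldQM.MFun Γ (k - 2 * (i : ℕ)) (m - (i : ℕ)))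
          (DrinfeldQM.falseEisenstein π ^ (i : ℕ))) ∧
      DrinfeldQM.QMFun Γ k m ℓ = (⨆ i : Fin (ℓ + 1),
        DrinfeldQM.timesFun (DrinfeldQM.MFun Γ (k - 2 * (i : ℕ)) (m - (i : ℕ)))
          (DrinfeldQM.falseEisenstein π ^ (i : ℕ))) ∧
      (∀ f ∈ DrinfeldQM.QMFun Γ k m ℓ,
        ∃! g : Fin (ℓ + 1) → DrinfeldQM.Omega Fq → DrinfeldQM.CInfty Fq,
          (∀ i : Fin (ℓ + 1), g i ∈ DrinfeldQM.MFun Γ (k - 2 * (i : ℕ)) (m - (i : ℕ))) ∧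
            f = ∑ i, g i * DrinfeldQM.falseEisenstein π ^ (i : ℕ)) ∧
      (∀ f ∈ DrinfeldQM.QMFunDepth Γ k m ℓ, f ≠ 0 →
        ∃ g : Fin (ℓ + 1) → DrinfeldQM.Omega Fq → DrinfeldQM.CInfty Fq,
          (∀ i : Fin (ℓ + 1), g i ∈ DrinfeldQM.MFun Γ (k - 2 * (i : ℕ)) (m - (i : ℕ))) ∧
            f = ∑ i, g i * DrinfeldQM.falseEisenstein π ^ (i : ℕ) ∧ g (Fin.last ℓ) ≠ 0)) ∧
    -- quasi-modular forms
    ((iSupIndep fun i : Fin (ℓ + 1) =>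
        DrinfeldQM.timesFun (DrinfeldQM.MForm Γ (k - 2 * (i : ℕ)) (m - (i : ℕ)))
          (DrinfeldQM.falseEisenstein π ^ (i : ℕ))) ∧
      DrinfeldQM.QMForm Γ k m ℓ = (⨆ i : Fin (ℓ + 1),
        DrinfeldQM.timesFun (DrinfeldQM.MForm Γ (k - 2 * (i : ℕ)) (m - (i : ℕ)))
          (DrinfeldQM.falseEisenstein π ^ (i : ℕ))) ∧
      (∀ f ∈ DrinfeldQM.QMForm Γ k m ℓ,
        ∃! g : Fin (ℓ + 1) → DrinfeldQM.Omega Fq → DrinfeldQM.CInfty Fq,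
          (∀ i : Fin (ℓ + 1), g i ∈ DrinfeldQM.MForm Γ (k - 2 * (i : ℕ)) (m - (i : ℕ))) ∧
            f = ∑ i, g i * DrinfeldQM.falseEisenstein π ^ (i : ℕ)) ∧
      (∀ f ∈ DrinfeldQM.QMFormDepth Γ k m ℓ, f ≠ 0 →
        ∃ g : Fin (ℓ + 1) → DrinfeldQM.Omega Fq → DrinfeldQM.CInfty Fq,
          (∀ i : Fin (ℓ + 1), g i ∈ DrinfeldQM.MForm Γ (k - 2 * (i : ℕ)) (m - (i : ℕ))) ∧
            f = ∑ i, g i * DrinfeldQM.falseEisenstein π ^ (i : ℕ) ∧ g (Fin.last ℓ) ≠ 0)) := by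
  have hFun := DrinfeldQM.decomposition_of_isModular (V := DrinfeldQM.QMFun Γ k m ℓ)
    (W := fun i => DrinfeldQM.MFun Γ (k - 2 * (i : ℕ)) (m - (i : ℕ))) hΓ hΓA hπ.1
    (fun _ => DrinfeldQM.mem_QMFun_iff) (fun _ _ => DrinfeldQM.mem_MFun_iff)
  have hForm := DrinfeldQM.decomposition_of_isModular (V := DrinfeldQM.QMForm Γ k m ℓ)
    (W := fun i => DrinfeldQM.MForm Γ (k - 2 * (i : ℕ)) (m - (i : ℕ))) hΓ hΓA hπ.1
    (fun _ => DrinfeldQM.mem_QMForm_iff) (fun _ _ => DrinfeldQM.mem_MForm_iff)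
  refine ⟨⟨hFun.1, hFun.2.1, hFun.2.2, fun f hf hf0 => ?_⟩,
    hForm.1, hForm.2.1, hForm.2.2, fun f hf hf0 => ?_⟩
  · obtain ⟨g, hg, h⟩ := DrinfeldQM.exists_top_ne_zero_of_mem hΓ hΓA hπ.1 hf hf0
      (DrinfeldQM.mem_QMFun_iff.1 ⟨ℓ, le_rfl, hf⟩)
    exact ⟨g, fun i => DrinfeldQM.mem_MFun_iff.2 (hg i), h⟩
  · obtain ⟨g, hg, h⟩ := DrinfeldQM.exists_top_ne_zero_of_mem hΓ hΓA hπ.1 hf.1 hf0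
      (DrinfeldQM.mem_QMForm_iff.1 ⟨ℓ, le_rfl, hf⟩)
    exact ⟨g, fun i => DrinfeldQM.mem_MForm_iff.2 (hg i), h⟩
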